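/- Let $\mathbb{T}=\mathbb{R}^3/\mathbb{Z}^3$, let $\{\pm1\}$ act on $\mathbb{T}$ by $x\mapsto -x$, and let $\pi\colon\mathbb{T}\to\mathbb{T}/\{\pm1\}$ be the quotient map onto the quotient orbifold. For a smooth manifold $X$ (possibly with boundary), a continuous map $f\colon X\to\mathbb{T}/\{\pm1\}$ is called smooth if every point of $X$ has an open neighbourhood $U$ with a $C^\infty$ map $\tilde f\colon U\to\mathbb{T}$ such that $\pi\circ\tilde f=f|_U$. Two smooth maps $f_0,f_1\colon M\to\mathbb{T}/\{\pm1\}$ are called (smoothly) homotopic if there is a smooth map $F\colon[0,1]\times M\to\mathbb{T}/\{\pm1\}$ with $F(0,\cdot)=f_0$ and $F(1,\cdot)=f_1$. Let $M$ be a compact oriented smooth manifold without boundary of dimension $m=k+l$ with $k,l\ge 0$. Let $\omega\in\Omega^k(M)$ be a closed smooth form and let $\Theta\in\Omega^{l}(\mathbb{T})$ be a closed smooth form which is invariant under pullback by the $\{\pm1\}$-action. Then: 1. For every smooth map $f\colon M\to\mathbb{T}/\{\pm1\}$ there is a well-defined smooth form $f^*\Theta\in\Omega^{l}(M)$, given on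 $U$ by $f^*\Theta|_U=\tilde f^*\Theta$ for every open $U\subseteq M$ and every $C^\infty$ map $\tilde f\colon U\to\mathbb{T}$ with $\pi\circ\tilde f=f|_U$. 2. The integral $\int_M\omega\wedge f^*\Theta$ depends only on the smooth homotopy class of $f$: if $f_0,f_1\colon M\to\mathbb{T}/\{\pm1\}$ are smooth and homotopic, then $$\int_M\omega\wedge f_0^*\Theta=\int_M\omega\wedge f_1^*\Theta.$$ -/

import Mathlib

open scoped Manifold ContDiff Topology
open Set MeasureTheory

noncomputable section

namespace OrbifoldHomotopy

/-! ### The torus `ℝ³ / ℤ³` and its quotient by `{±1}` -/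

/-- The model space `ℝⁿ` with its Euclidean structure. -/
abbrev E (n : ℕ) : Type := EuclideanSpace ℝ (Fin n)

/-- The lattice `ℤ³ ⊆ ℝ³`. -/
def lattice : AddSubgroup (E 3) where
  carrier := {v | ∀ i, ∃ a : ℤ, v i = a}
  zero_mem' := fun _ => ⟨0, by simp⟩
  add_mem' := by
    intro v w hv hw i
    obtain ⟨a, ha⟩ := hv i
    obtain ⟨b, hb⟩ := hw i
    exact ⟨a + b, by simp [ha, hb]⟩
  neg_mem' := by
    intro v hv i
    obtain ⟨a, ha⟩ := hv i
    exact ⟨-a, by simp [ha]⟩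

theorem eq_zero_of_mem_lattice {v : E 3} (hv : v ∈ lattice) (h : ‖v‖ < 1) : v = 0 := by
  ext i
  obtain ⟨a, ha⟩ := hv i
  have h1 : ‖v i‖ < 1 := (PiLp.norm_apply_le v i).trans_lt h
  rw [ha, Real.norm_eq_abs, ← Int.cast_abs] at h1
  have h2 : |a| < 1 := by exact_mod_cast h1
  rw [ha, Int.abs_lt_one_iff.mp h2]
  simp

instance : DiscreteTopology lattice := by
  refine discreteTopology_of_isOpen_singleton_zero ?_
  have : ({0} : Set lattice) = Subtype.val ⁻¹' Metric.ball (0 : E 3) 1 := by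
    ext v
    simp only [mem_singleton_iff, mem_preimage, mem_ball_zero_iff]
    refine ⟨fun h => by simp [h], fun h => ?_⟩
    exact Subtype.ext (eq_zero_of_mem_lattice v.2 h)
  rw [this]
  exact Metric.isOpen_ball.preimage continuous_subtype_val

/-- The torus `𝕋 = T³ = ℝ³ / ℤ³`. -/
abbrev Torus : Type := E 3 ⧸ lattice

/-- The projection `ℝ³ → T³`. -/
def toTorus : E 3 → Torus := QuotientAddGroup.mk

theorem toTorus_surjective : Function.Surjective toTorus := QuotientAddGroup.mk_surjective

theorem toTorus_eq_iff {v w : E 3} : toTorus v = toTorus w ↔ w - v ∈ lattice := by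
  rw [toTorus, QuotientAddGroup.eq, neg_add_eq_sub]

theorem isLocalHomeomorph_toTorus : IsLocalHomeomorph toTorus :=
  (AddSubgroup.isAddQuotientCoveringMap_of_comm lattice
    ⟨inferInstanceAs (DiscreteTopology lattice)⟩).isCoveringMap.isLocalHomeomorph

/-- The manifold structure of `T³`: the charts are the local inverses of `ℝ³ → T³`. -/
instance : ChartedSpace (E 3) Torus :=
  isLocalHomeomorph_toTorus.chartedSpace toTorus_surjective

/-- The transition maps between these charts are locally translations, hence smooth. -/
instance : IsManifold (𝓡 3) ∞ Torus := by
  refine isManifold_of_contDiffOn _ _ _ ?_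
  rintro _ _ ⟨p, rfl⟩ ⟨q, rfl⟩
  set g := toTorus_surjective.hasRightInverse.choose
  set e := (isLocalHomeomorph_toTorus.localInverseAt (g p)).trans (chartAt (E 3) (g p)) with he
  set e' := (isLocalHomeomorph_toTorus.localInverseAt (g q)).trans (chartAt (E 3) (g q)) with he'
  intro x hx
  have hS : IsOpen (e.symm ≫ₕ e').source := (e.symm ≫ₕ e').open_source
  have hxS : x ∈ (e.symm ≫ₕ e').source := by simpa using hx
  have key : ∀ y ∈ (e.symm ≫ₕ e').source, (e.symm ≫ₕ e') y - y ∈ lattice := by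
    intro y hy
    rw [← toTorus_eq_iff]
    have h1 : e.symm y ∈ e'.source := by simpa using hy.2
    have h2 : e.symm y = toTorus y := by
      simp [he, chartAt_self_eq (H := E 3)]
    have h3 : toTorus (e' (e.symm y)) = e.symm y := by
      have := e'.left_inv h1
      simpa [he', chartAt_self_eq (H := E 3)] using this
    rw [← h2, ← h3]
    simp
  have hcont : ContinuousAt (fun y => (e.symm ≫ₕ e') y - y) x :=
    ((e.symm ≫ₕ e').continuousAt hxS).sub continuousAt_id
  have hev : (e.symm ≫ₕ e') =ᶠ[𝓝 x] fun y => y + ((e.symm ≫ₕ e') x - x) := by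
    filter_upwards [hS.mem_nhds hxS, Metric.continuousAt_iff'.mp hcont 1 one_pos] with y hy hd
    rw [dist_eq_norm] at hd
    have := eq_zero_of_mem_lattice (lattice.sub_mem (key y hy) (key x hxS)) hd
    have h5 := sub_eq_zero.mp this
    rw [← h5]; abel
  have hsm : ContDiffAt ℝ ∞ (e.symm ≫ₕ e') x :=
    (contDiffAt_id.add contDiffAt_const).congr_of_eventuallyEq hev
  simpa using! hsm.contDiffWithinAt

/-- The orbifold `T³ / {±1}` (as a topological space), the orbit space of the action
of `ℤˣ = {±1}` on the torus, `(-1) • x = -x`. -/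
abbrev QuotientTorus : Type := MulAction.orbitRel.Quotient ℤˣ Torus

/-- The quotient map `π : T³ → T³ / {±1}`. -/
def proj : Torus → QuotientTorus := Quotient.mk _

theorem proj_eq_iff {x y : Torus} : proj x = proj y ↔ x = y ∨ x = -y := by
  rw [proj, Quotient.eq, MulAction.orbitRel_apply, MulAction.mem_orbit_iff]
  constructor
  · rintro ⟨u, rfl⟩
    rcases Int.units_eq_one_or u with rfl | rfl
    · left; simp
    · right; simp [Units.smul_def]
  · rintro (rfl | rfl)
    · exact ⟨1, by simp⟩
    · exact ⟨-1, by simp [Units.smul_def]⟩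

/-! ### Differential forms on manifolds -/

section Forms

variable {n n' k l m : ℕ}
  {M : Type*} [TopologicalSpace M] [ChartedSpace (E n) M]
  {N : Type*} [TopologicalSpace N] [ChartedSpace (E n') N]

/-- (Not necessarily smooth) differential `k`-forms on an `n`-manifold `M`: families of alternating
`k`-linear forms on the tangent spaces. -/
abbrev Form (n : ℕ) (M : Type*) [TopologicalSpace M] [ChartedSpace (E n) M] (k : ℕ) : Type _ :=
  ∀ x : M, TangentSpace (𝓡 n) x [⋀^Fin k]→L[ℝ] ℝ

/-- The pullback `g^*Θ`, `(g^*Θ)_x = Θ_{g x} ∘ (dg_x × ⋯ × dg_x)`. -/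
def pullback (g : M → N) (Θ : Form n' N k) : Form n M k :=
  fun x => (Θ (g x)).compContinuousLinearMap (mfderiv (𝓡 n) (𝓡 n') g x)

/-- The coordinate expression of `α` in the chart `φ` around `c`: the form `(φ⁻¹)^*α` on the open
set `φ.target ⊆ ℝⁿ`. -/
def inChart (α : Form n M k) (c : M) : E n → E n [⋀^Fin k]→L[ℝ] ℝ :=
  pullback (chartAt (E n) c).symm α

/-- `α` is smooth, i.e. its coordinate expressions are `C^∞`. -/
def IsSmoothForm (α : Form n M k) : Prop :=
  ∀ c : M, ContDiffOn ℝ ∞ (inChart α c) (chartAt (E n) c).target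

/-- `α` is closed: `dα = 0`, computed in the charts. -/
def IsClosedForm (α : Form n M k) : Prop :=
  ∀ c : M, ∀ y ∈ (chartAt (E n) c).target, extDeriv (inChart α c) y = 0

/-- The wedge product of alternating forms (sum over shuffles),
`(α ∧ β)(v) = (1 / (k! l!)) ∑_σ sign σ • α (v_σ(1), …, v_σ(k)) β (v_σ(k+1), …, v_σ(k+l))`. -/
def wedge {V : Type*} [AddCommGroup V] [Module ℝ V] [TopologicalSpace V]
    (h : k + l = m)
    (α : V [⋀^Fin k]→L[ℝ] ℝ) (β : V [⋀^Fin l]→L[ℝ] ℝ) : V [⋀^Fin m]→L[ℝ] ℝ :=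
  let γ : V [⋀^Fin m]→ₗ[ℝ] ℝ :=
    ((LinearMap.mul' ℝ ℝ).compAlternatingMap
      (α.toAlternatingMap.domCoprod β.toAlternatingMap)).domDomCongr
        (finSumFinEquiv.trans (finCongr h))
  { γ with
    cont := by
      change Continuous fun v : Fin m → V => γ v
      simp only [γ, AlternatingMap.domDomCongr_apply, LinearMap.compAlternatingMap_apply,
        AlternatingMap.domCoprod_apply, sum_apply, map_sum]
      refine continuous_finsetSum _ fun σ _ => ?_
      induction σ using Quotient.inductionOn' with | _ σ
      rw [AlternatingMap.domCoprod.summand_mk'']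
      have key : Continuous fun v : Fin m → V =>
          α (fun i => v (finCongr h (finSumFinEquiv (σ (Sum.inl i))))) *
            β (fun i => v (finCongr h (finSumFinEquiv (σ (Sum.inr i))))) := by
        refine Continuous.mul ?_ ?_
        · exact α.cont.comp (continuous_pi fun i => continuous_apply _)
        · exact β.cont.comp (continuous_pi fun i => continuous_apply _)
      rcases Int.units_eq_one_or (Equiv.Perm.sign σ) with hσ | hσ
      · rw [hσ, one_smul]
        exact key
      · rw [hσ, Units.neg_smul, one_smul]
        simp only [neg_apply, map_neg]
        exact key.neg }

/-- The wedge product `α ∧ β` of differential forms. -/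
def wedgeForm (h : k + l = m) (α : Form n M k) (β : Form n M l) : Form n M m :=
  fun x => wedge h (α x) (β x)

end Forms

/-! ### Integration on compact oriented manifolds -/

section Integration

variable {m : ℕ} {M : Type*} [TopologicalSpace M] [ChartedSpace (E m) M]

variable (m M) in
/-- An orientation of the `m`-manifold `M`, given by a smooth nowhere vanishing `m`-form (a frame is
positive if the form is positive on it). -/
structure OrientationForm where
  /-- The nowhere vanishing top degree form. -/
  form : Form m M m
  smooth : IsSmoothForm form
  ne_zero : ∀ x, form x ≠ 0

/-- The standard frame `(e₁, …, e_m)` of `ℝᵐ`. -/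
def stdFrame (m : ℕ) : Fin m → E m := fun i => EuclideanSpace.single i 1

variable (m M) in
/-- A smooth partition of unity subordinate to the cover of `M` by chart domains. -/
def chartPartition [IsManifold (𝓡 m) ∞ M] [T2Space M] [CompactSpace M] :
    SmoothPartitionOfUnity M (𝓡 m) M univ :=
  (SmoothPartitionOfUnity.exists_isSubordinate_chartAt_source (𝓡 m) M).choose

/-- The integral `∫_M α` of an `m`-form over the compact oriented `m`-manifold `M`,
`∑_c ∫_{φ_c(U_c)} ± (φ_c⁻¹)^*(ρ_c α)`, where `ρ` is a partition of unity subordinate to the charts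
`φ_c : U_c → ℝᵐ`, and the sign at a point is `+` if `φ_c` preserves the orientation there and `-`
otherwise. (The sum is finite since `M` is compact.) -/
def integralForm [IsManifold (𝓡 m) ∞ M] [T2Space M] [CompactSpace M]
    (o : OrientationForm m M) (α : Form m M m) : ℝ :=
  ∑ᶠ c : M, ∫ y in (chartAt (E m) c).target,
    Real.sign (inChart o.form c y (stdFrame m)) *
      (chartPartition m M c ((chartAt (E m) c).symm y) * inChart α c y (stdFrame m))

end Integration

/-! ### Smooth maps to the orbifold `T³ / {±1}` -/

section Orbifold

variable {V : Type*} [NormedAddCommGroup V] [NormedSpace ℝ V] {H : Type*} [TopologicalSpace H]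
  (I : ModelWithCorners ℝ V H) {X : Type*} [TopologicalSpace X] [ChartedSpace H X]

/-- `g` is a `C^∞` lift of `f : X → T³ / {±1}` to the torus on the open set `U` (the values of `g`
outside `U` are irrelevant). -/
structure IsSmoothLift (f : X → QuotientTorus) (U : Set X) (g : X → Torus) : Prop where
  isOpen : IsOpen U
  contMDiffOn : ContMDiffOn I (𝓡 3) ∞ g U
  proj_eq : ∀ x ∈ U, proj (g x) = f x

/-- Smooth maps from a manifold (possibly with boundary) to the orbifold `T³ / {±1}`: continuous
maps having a `C^∞` lift to the torus near every point. At a point mapped to the regular part of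
`T³ / {±1}`, near which `π` is a local diffeomorphism by definition of the manifold structure of the
regular part, this says that `f` is a `C^∞` map there. -/
structure IsSmoothOrbifoldMap (f : X → QuotientTorus) : Prop where
  continuous : Continuous f
  exists_lift : ∀ x, ∃ (U : Set X) (g : X → Torus), x ∈ U ∧ IsSmoothLift I f U g

end Orbifold

section Homotopy

variable {m k : ℕ} {M : Type*} [TopologicalSpace M] [ChartedSpace (E m) M]

/-- The pullback `f^*Θ` of a `{±1}`-invariant form on the torus by a smooth map `f` to `T³ / {±1}`:
at `x` it is `(g^*Θ)_x` for a local lift `g` of `f` near `x`. -/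
def orbifoldPullback {f : M → QuotientTorus} (hf : IsSmoothOrbifoldMap (𝓡 m) f)
    (Θ : Form 3 Torus k) : Form m M k :=
  fun x => pullback (n := m) (hf.exists_lift x).choose_spec.choose Θ x

/-- `Θ` is invariant under pullback by the action of `{±1}` on the torus. -/
def IsInvariantForm (Θ : Form 3 Torus k) : Prop :=
  pullback (fun x : Torus => -x) Θ = Θ

/-- `f₀` and `f₁` are smoothly homotopic: there is a smooth `F : [0,1] × M → T³ / {±1}` with
`F (0, ·) = f₀` and `F (1, ·) = f₁`. -/
def SmoothlyHomotopic (m : ℕ) {M : Type*} [TopologicalSpace M] [ChartedSpace (E m) M]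
    (f₀ f₁ : M → QuotientTorus) : Prop :=
  ∃ F : Icc (0 : ℝ) 1 × M → QuotientTorus,
    IsSmoothOrbifoldMap ((𝓡∂ 1).prod (𝓡 m)) F ∧
      (∀ x, F (0, x) = f₀ x) ∧ (∀ x, F (1, x) = f₁ x)

end Homotopy

end OrbifoldHomotopy

end

/-!
Everything is computed in charts, with forms on open subsets of normed spaces.

A closed smooth invariant form `Θ` on the torus corresponds to a form `θ = liftForm Θ` on `ℝ³` that
is closed, periodic and even (`IsCrystalForm`), and a map to `T³ / {±1}` with local lifts to the
torus has local lifts to `ℝ³`. Two lifts agree, at each point, up to sign and lattice translation.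
The sign may jump at the points mapped to the singular locus, where neither "`u' - u` is locally
constant" nor "`u' + u` is locally constant" need hold; but one of the two holds near a dense set of
points, and there the two pullbacks of `θ` agree. As both pullbacks are continuous, they agree
everywhere (`IsEuclideanLift.pull_eq`). Hence `f^*Θ` is well defined, smooth and natural, and it is
closed because it is locally the pullback of a closed form by a smooth map.

For the homotopy invariance, a homotopy `F` is reparametrized by a smooth step function, so that it
is defined on `ℝ × M` and no boundary is left. The form `λ = α ∧ F^*Θ` on `ℝ × M` is closed; that
the wedge product of closed forms is closed (`extDeriv_wedge_eq_zero`) is proved by rearranging the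
double sum over permutations that computes its exterior derivative. Let `ρ` be the partition
of unity in the definition of the integral. For each index `c`, Stokes' theorem for the form `ρ_c λ`
on `ℝ × ℝᵐ`, supported in some `ℝ × K` with `K` compact (`hasDerivAt_integral_sliceFrame`), says that
the derivative in `t` of `∫ ρ_c λ` over `{t} × M` is the integral of `ι_{∂ₜ} (dρ_c ∧ λ)`. These integrals are taken in
different charts; cutting them into pieces with the partition of unity and moving the pieces to a
common chart by change of variables (`setIntegral_eq_of_transition`), their sum becomes the
integral of `ι_{∂ₜ} (d(∑ ρ_c) ∧ λ) = 0` (`sum_integral_boundaryDensity`). So the integral of `λ`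
over `{t} × M` is constant in `t`. Contracting with `∂ₜ` keeps all forms in degrees `m` and `m + 1`,
so that `m = 0` needs no separate treatment.
-/

noncomputable section

namespace OrbifoldHomotopy

/-! ### Alternating sums over permutations -/

section Alternating

open Equiv

variable {V : Type*} [NormedAddCommGroup V] [NormedSpace ℝ V] {k l m n : ℕ}

/-- The wedge product as a sum over all permutations instead of shuffles. -/
theorem mul_wedge_apply (h : k + l = m) (α : V [⋀^Fin k]→L[ℝ] ℝ) (β : V [⋀^Fin l]→L[ℝ] ℝ)
    (v : Fin m → V) :
    ((k.factorial * l.factorial : ℕ) : ℝ) * wedge h α β v =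
      ∑ σ : Perm (Fin m), ((Perm.sign σ : ℤ) : ℝ) *
        (α (fun i => v (σ ((finSumFinEquiv.trans (finCongr h)) (Sum.inl i)))) *
          β (fun i => v (σ ((finSumFinEquiv.trans (finCongr h)) (Sum.inr i))))) := by
  set s : Fin k ⊕ Fin l ≃ Fin m := finSumFinEquiv.trans (finCongr h) with hs
  have h1 := MultilinearMap.domCoprod_alternization_eq α.toAlternatingMap β.toAlternatingMap
  have h2 := congrArg (fun f => (LinearMap.mul' ℝ ℝ) (f (v ∘ s))) h1
  have h3 : wedge h α β v = (LinearMap.mul' ℝ ℝ)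
      ((α.toAlternatingMap.domCoprod β.toAlternatingMap) (v ∘ s)) := rfl
  simp only [Fintype.card_fin] at h2
  rw [h3, ← nsmul_eq_mul, ← map_nsmul]
  refine (Eq.trans h2.symm ?_)
  rw [MultilinearMap.alternatization_apply, map_sum]
  rw [← (s.permCongr).sum_comp]
  refine Finset.sum_congr rfl fun σ _ => ?_
  rw [Perm.sign_permCongr]
  rcases Int.units_eq_one_or (Perm.sign σ) with hσ | hσ <;> rw [hσ] <;>
    simp [Equiv.permCongr_apply, MultilinearMap.domDomCongr_apply]

/-- The alternatization defining the exterior derivative, written as a sum over all permutations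
of the arguments. -/
theorem factorial_mul_alternatizeUncurryFin_apply (f : V →L[ℝ] V [⋀^Fin n]→L[ℝ] ℝ)
    (v : Fin (n + 1) → V) :
    (n.factorial : ℝ) * ContinuousAlternatingMap.alternatizeUncurryFin f v =
      ∑ σ : Perm (Fin (n + 1)), ((Perm.sign σ : ℤ) : ℝ) *
        f (v (σ 0)) (fun i => v (σ i.succ)) := by
  rw [← (Perm.decomposeFin (n := n)).symm.sum_comp, Fintype.sum_prod_type,
    ContinuousAlternatingMap.alternatizeUncurryFin_apply, Finset.mul_sum]
  refine Finset.sum_congr rfl fun p _ => ?_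
  have key : ∀ e : Perm (Fin n), ((Perm.sign (Perm.decomposeFin.symm (p, e)) : ℤ) : ℝ) *
      f (v (Perm.decomposeFin.symm (p, e) 0))
        (fun i => v (Perm.decomposeFin.symm (p, e) i.succ)) =
      (-1) ^ (p : ℕ) • f (v p) (p.removeNth v) := by
    intro e
    simp only [Perm.decomposeFin_symm_apply_zero, Perm.decomposeFin_symm_apply_succ,
      Perm.decomposeFin.symm_sign]
    have h1 : f (v p) (fun i => v (swap 0 p (e i).succ)) =
        ((Perm.sign e : ℤ) : ℝ) * f (v p) (fun i => v (swap 0 p i.succ)) := by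
      have := (f (v p)).toAlternatingMap.map_perm (fun i => v (swap 0 p i.succ)) e
      simp only [ContinuousAlternatingMap.coe_toAlternatingMap] at this
      refine Eq.trans this ?_
      rcases Int.units_eq_one_or (Perm.sign e) with hσ | hσ <;> rw [hσ] <;> simp
    have hsq : ((Perm.sign e : ℤ) : ℝ) * ((Perm.sign e : ℤ) : ℝ) = 1 := by
      rcases Int.units_eq_one_or (Perm.sign e) with hσ | hσ <;> rw [hσ] <;> simp
    rw [h1]
    by_cases hp : p = 0
    · subst hp
      have h0 : (fun i : Fin n => v i.succ) = Fin.removeNth 0 v := by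
        ext i; simp [Fin.removeNth]
      simp only [swap_self, refl_apply, h0, if_true, Fin.val_zero, pow_zero, one_smul, one_mul]
      rw [← mul_assoc, hsq, one_mul]
    · -- replacing the `p`-th vector by the `0`-th one gives a tuple with a repeated entry
      have h2 := (f (v p)).neg_one_pow_smul_map_removeNth_add_eq_zero_of_eq
        (v := Function.update v p (v 0)) (i := 0) (j := p)
        (by rw [Function.update_of_ne (Ne.symm hp), Function.update_self]) (Ne.symm hp)
      have h3 : Fin.removeNth p (Function.update v p (v 0)) = Fin.removeNth p v := by
        ext i; simp [Fin.removeNth]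
      have h4 : Fin.removeNth 0 (Function.update v p (v 0)) =
          fun i => v (swap 0 p i.succ) := by
        ext i
        simp only [Fin.removeNth, Fin.zero_succAbove]
        by_cases hi : i.succ = p
        · rw [hi, swap_apply_right, Function.update_self]
        · rw [Function.update_of_ne hi, swap_apply_of_ne_of_ne (Fin.succ_ne_zero i) hi]
      rw [h3, h4] at h2
      simp only [Fin.val_zero, pow_zero, one_smul] at h2
      have h5 := eq_neg_of_add_eq_zero_left h2
      rw [h5, if_neg hp]
      push_cast
      linear_combination (-1) ^ (p : ℕ) • (f (v p)) (p.removeNth v) * hsq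
  rw [Finset.sum_congr rfl fun e _ => key e]
  simp [Fintype.card_perm]

/-- If `f` alternates to zero, then so does the product of `f` with any function of further
arguments: in the sum over all permutations, the permutations of the arguments of `f` can be
summed first. -/
theorem sum_perm_mul_eq_zero {p q : ℕ} {J : Type*} [Fintype J] [DecidableEq J]
    (e : Fin (p + 1) ⊕ Fin q ≃ J) {f : V →L[ℝ] V [⋀^Fin p]→L[ℝ] ℝ}
    (hf : ContinuousAlternatingMap.alternatizeUncurryFin f = 0) (T : (Fin q → V) → ℝ) (v : J → V) :
    ∑ σ : Perm J, ((Perm.sign σ : ℤ) : ℝ) *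
      (f (v (σ (e (Sum.inl 0)))) (fun i => v (σ (e (Sum.inl i.succ)))) *
        T (fun i => v (σ (e (Sum.inr i))))) = 0 := by
  set F : Perm J → ℝ := fun σ => ((Perm.sign σ : ℤ) : ℝ) *
      (f (v (σ (e (Sum.inl 0)))) (fun i => v (σ (e (Sum.inl i.succ)))) *
        T (fun i => v (σ (e (Sum.inr i)))))
  let ι : Perm (Fin (p + 1)) → Perm J := fun τ => e.permCongr (Equiv.sumCongr τ 1)
  have h1 : ∀ τ, ∑ σ, F (σ * ι τ) = ∑ σ, F σ := fun τ => Equiv.sum_comp (Equiv.mulRight (ι τ)) F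
  have h2 : ∑ τ, ∑ σ, F (σ * ι τ) = 0 := by
    rw [Finset.sum_comm]
    refine Finset.sum_eq_zero fun σ _ => ?_
    have h3 := factorial_mul_alternatizeUncurryFin_apply f (fun i => v (σ (e (Sum.inl i))))
    rw [hf] at h3
    calc ∑ τ, F (σ * ι τ) = ∑ τ : Perm (Fin (p + 1)), ((Perm.sign σ : ℤ) : ℝ) *
          T (fun i => v (σ (e (Sum.inr i)))) * (((Perm.sign τ : ℤ) : ℝ) *
            f (v (σ (e (Sum.inl (τ 0))))) (fun i => v (σ (e (Sum.inl (τ i.succ)))))) := by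
          refine Finset.sum_congr rfl fun τ _ => ?_
          have hs : Perm.sign (ι τ) = Perm.sign τ := by
            have := Perm.sign_sumCongr τ (1 : Perm (Fin q))
            simp only [ι, Perm.sign_permCongr]
            refine Eq.trans this ?_
            simp
          simp only [F, Perm.sign_mul, hs]
          simp only [ι, Perm.mul_apply, Equiv.permCongr_apply, symm_apply_apply,
            Equiv.sumCongr_apply, Sum.map_inl, Sum.map_inr, Perm.one_apply]
          push_cast
          ring
      _ = 0 := by
          rw [← Finset.mul_sum, ← h3]
          simp
  rw [Finset.sum_congr rfl fun τ _ => h1 τ, Finset.sum_const, nsmul_eq_mul] at h2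
  refine (mul_eq_zero.mp h2).resolve_left ?_
  simp

end Alternating

/-! ### Smoothness and closedness of wedge products -/

section Smoothness

variable {D V : Type*} [NormedAddCommGroup D] [NormedSpace ℝ D] [NormedAddCommGroup V]
  [NormedSpace ℝ V] {k l m : ℕ} {n : WithTop ℕ∞}

/-- A map into the alternating forms on a finite dimensional space is smooth as soon as all its
evaluations are, because finitely many evaluations embed the space of forms linearly. -/
theorem contDiffAt_of_forall_apply [FiniteDimensional ℝ V] {f : D → V [⋀^Fin k]→L[ℝ] ℝ} {x : D}
    (hf : ∀ v, ContDiffAt ℝ n (fun y => f y v) x) : ContDiffAt ℝ n f x := by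
  let b := Module.finBasis ℝ V
  let ev : (V [⋀^Fin k]→L[ℝ] ℝ) →ₗ[ℝ] ((Fin k → Fin (Module.finrank ℝ V)) → ℝ) :=
    { toFun := fun f r => f (fun i => b (r i))
      map_add' := fun _ _ => rfl
      map_smul' := fun _ _ => rfl }
  have hev : LinearMap.ker ev = ⊥ := LinearMap.ker_eq_bot.mpr fun f g hfg => by
    apply ContinuousAlternatingMap.toAlternatingMap_injective
    exact Module.Basis.ext_alternating b fun r _ => congrFun hfg r
  obtain ⟨g, hg⟩ := ev.exists_leftInverse_of_injective hev
  have h1 : f = fun y => (LinearMap.toContinuousLinearMap g) (ev (f y)) := by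
    ext1 y
    exact (LinearMap.congr_fun hg (f y)).symm
  rw [h1]
  exact (LinearMap.toContinuousLinearMap g).contDiff.contDiffAt.comp x
    (contDiffAt_pi.mpr fun r => hf _)

theorem _root_.ContDiffAt.continuousAlternatingMap_apply {f : D → V [⋀^Fin k]→L[ℝ] ℝ}
    {v : Fin k → D → V} {x : D} (hf : ContDiffAt ℝ n f x) (hv : ∀ i, ContDiffAt ℝ n (v i) x) :
    ContDiffAt ℝ n (fun y => f y (fun i => v i y)) x := by
  let c : (V [⋀^Fin k]→L[ℝ] ℝ) →L[ℝ] ContinuousMultilinearMap ℝ (fun _ : Fin k => V) ℝ :=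
    ContinuousAlternatingMap.toContinuousMultilinearMapCLM ℝ
  have h := c.analyticAt_uncurry_of_multilinear (x := (f x, fun i => v i x))
  exact (h.contDiffAt (n := n)).comp x (hf.prodMk (contDiffAt_pi.mpr hv))

theorem contDiffAt_compContinuousLinearMap [FiniteDimensional ℝ V] {V' : Type*}
    [NormedAddCommGroup V'] [NormedSpace ℝ V'] {f : D → V' [⋀^Fin k]→L[ℝ] ℝ} {A : D → V →L[ℝ] V'}
    {x : D} (hf : ContDiffAt ℝ n f x) (hA : ContDiffAt ℝ n A x) :
    ContDiffAt ℝ n (fun y => (f y).compContinuousLinearMap (A y)) x :=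
  contDiffAt_of_forall_apply fun _ =>
    hf.continuousAlternatingMap_apply fun _ => hA.clm_apply contDiffAt_const

theorem wedge_eq (h : k + l = m) (α : V [⋀^Fin k]→L[ℝ] ℝ) (β : V [⋀^Fin l]→L[ℝ] ℝ)
    (v : Fin m → V) : wedge h α β v = ((k.factorial * l.factorial : ℕ) : ℝ)⁻¹ *
      ∑ σ : Equiv.Perm (Fin m), ((Equiv.Perm.sign σ : ℤ) : ℝ) *
        (α (fun i => v (σ ((finSumFinEquiv.trans (finCongr h)) (Sum.inl i)))) *
          β (fun i => v (σ ((finSumFinEquiv.trans (finCongr h)) (Sum.inr i))))) := by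
  rw [← mul_wedge_apply, inv_mul_cancel_left₀]
  exact_mod_cast mul_ne_zero (Nat.factorial_ne_zero k) (Nat.factorial_ne_zero l)

theorem wedge_compContinuousLinearMap {V' : Type*} [NormedAddCommGroup V'] [NormedSpace ℝ V']
    (h : k + l = m) (α : V [⋀^Fin k]→L[ℝ] ℝ) (β : V [⋀^Fin l]→L[ℝ] ℝ) (A : V' →L[ℝ] V) :
    (wedge h α β).compContinuousLinearMap A =
      wedge h (α.compContinuousLinearMap A) (β.compContinuousLinearMap A) := by
  ext v
  rw [wedge_eq, ContinuousAlternatingMap.compContinuousLinearMap_apply, wedge_eq]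
  rfl

theorem contDiffAt_wedge [FiniteDimensional ℝ V] (h : k + l = m) {α : D → V [⋀^Fin k]→L[ℝ] ℝ}
    {β : D → V [⋀^Fin l]→L[ℝ] ℝ} {x : D} (hα : ContDiffAt ℝ n α x) (hβ : ContDiffAt ℝ n β x) :
    ContDiffAt ℝ n (fun y => wedge h (α y) (β y)) x := by
  refine contDiffAt_of_forall_apply fun v => ?_
  simp only [wedge_eq]
  refine contDiffAt_const.mul (ContDiffAt.sum fun σ _ => contDiffAt_const.mul (.mul ?_ ?_))
  · exact hα.continuousAlternatingMap_apply fun _ => contDiffAt_const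
  · exact hβ.continuousAlternatingMap_apply fun _ => contDiffAt_const

/-- The distribution of `m + 1` arguments when the argument `0`, along which the derivative is
taken, is given to the second factor of a product (the `Fin (l + 1)` summand), and the others are
distributed by `s`, shifted by one. -/
def insertRight (s : Fin k ⊕ Fin l ≃ Fin m) : Fin (l + 1) ⊕ Fin k ≃ Fin (m + 1) :=
  Equiv.ofBijective
    (Sum.elim (Fin.cons 0 fun i => (s (Sum.inr i)).succ) fun i => (s (Sum.inl i)).succ) <| by
    refine (Fintype.bijective_iff_injective_and_card _).mpr ⟨?_, ?_⟩
    · rintro (i | i) (j | j)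
      · refine Fin.cases ?_ (fun i => ?_) i <;> refine Fin.cases ?_ (fun j => ?_) j <;>
          simp [Fin.succ_ne_zero, (Fin.succ_ne_zero _).symm]
      · refine Fin.cases ?_ (fun i => ?_) i <;> simp [(Fin.succ_ne_zero _).symm]
      · refine Fin.cases ?_ (fun j => ?_) j <;> simp [Fin.succ_ne_zero]
      · simp
    · have := Fintype.card_congr s
      simp at this ⊢
      omega

/-- The distribution of `m + 1` arguments as in `insertRight`, with the argument `0` given to the
first factor. -/
def insertLeft (s : Fin k ⊕ Fin l ≃ Fin m) : Fin (k + 1) ⊕ Fin l ≃ Fin (m + 1) :=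
  insertRight ((Equiv.sumComm _ _).trans s)

variable {x : V}

/-- The wedge product of closed forms is closed. In the sum over permutations computing
`d(α ∧ β)`, the terms in which the derivative falls on `α` alternate to a multiple of `dα ∧ β`, and
the others to a multiple of `α ∧ dβ`. -/
theorem extDeriv_wedge_eq_zero [FiniteDimensional ℝ V] (h : k + l = m)
    {α : V → V [⋀^Fin k]→L[ℝ] ℝ} {β : V → V [⋀^Fin l]→L[ℝ] ℝ}
    (hα : DifferentiableAt ℝ α x) (hβ : DifferentiableAt ℝ β x)
    (hlam : DifferentiableAt ℝ (fun y => wedge h (α y) (β y)) x)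
    (hα' : extDeriv α x = 0) (hβ' : extDeriv β x = 0) :
    extDeriv (fun y => wedge h (α y) (β y)) x = 0 := by
  set s : Fin k ⊕ Fin l ≃ Fin m := finSumFinEquiv.trans (finCongr h) with hs
  have hder : ∀ (u : V) (w : Fin m → V), ((k.factorial * l.factorial : ℕ) : ℝ) *
      fderiv ℝ (fun y => wedge h (α y) (β y)) x u w =
        ∑ τ : Equiv.Perm (Fin m), ((Equiv.Perm.sign τ : ℤ) : ℝ) *
          (fderiv ℝ α x u (fun i => w (τ (s (Sum.inl i)))) * β x (fun i => w (τ (s (Sum.inr i)))) +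
          α x (fun i => w (τ (s (Sum.inl i)))) *
            fderiv ℝ β x u (fun i => w (τ (s (Sum.inr i))))) := by
    intro u w
    have hdα := fun v => hα.continuousAlternatingMap_apply_const v
    have hdβ := fun v => hβ.continuousAlternatingMap_apply_const v
    have h1 : fderiv ℝ (fun y => ((k.factorial * l.factorial : ℕ) : ℝ) *
        wedge h (α y) (β y) w) x u = ((k.factorial * l.factorial : ℕ) : ℝ) *
          fderiv ℝ (fun y => wedge h (α y) (β y)) x u w := by
      rw [fderiv_const_mul (hlam.continuousAlternatingMap_apply_const w), smul_apply, smul_eq_mul,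
        fderiv_continuousAlternatingMap_apply_const_apply hlam]
    rw [← h1]
    simp only [mul_wedge_apply]
    rw [fderiv_fun_sum fun τ _ => ((hdα _).fun_mul (hdβ _)).const_mul _, sum_apply]
    refine Finset.sum_congr rfl fun τ _ => ?_
    rw [fderiv_const_mul ((hdα _).fun_mul (hdβ _)), fderiv_fun_mul (hdα _) (hdβ _),
      fderiv_continuousAlternatingMap_apply_const hα,
      fderiv_continuousAlternatingMap_apply_const hβ, ← hs]
    simp only [smul_apply, add_apply, smul_eq_mul,
      ContinuousLinearMap.flipAlternating_apply_apply]
    ring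
  -- `G σ` is the Leibniz term in which the vectors are permuted by `σ`. The permutations `τ` of the
  -- last `m` vectors in `hder` only reparametrize the sum over `σ`.
  ext v
  set G : Equiv.Perm (Fin (m + 1)) → ℝ := fun σ => ((Equiv.Perm.sign σ : ℤ) : ℝ) *
    (fderiv ℝ α x (v (σ 0)) (fun i => v (σ (s (Sum.inl i)).succ)) *
        β x (fun i => v (σ (s (Sum.inr i)).succ)) +
      α x (fun i => v (σ (s (Sum.inl i)).succ)) *
        fderiv ℝ β x (v (σ 0)) (fun i => v (σ (s (Sum.inr i)).succ))) with hG
  have hG0 : ∑ σ, G σ = 0 := by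
    have h1 := sum_perm_mul_eq_zero (insertLeft s) hα' (β x) v
    have h2 := sum_perm_mul_eq_zero (insertRight s) hβ' (α x) v
    rw [← add_zero (0 : ℝ)]
    nth_rw 1 [← h1]
    rw [← h2, ← Finset.sum_add_distrib]
    refine Finset.sum_congr rfl fun σ _ => ?_
    simp only [hG, insertLeft, insertRight, Equiv.ofBijective_apply, Sum.elim_inl, Sum.elim_inr,
      Fin.cons_zero, Fin.cons_succ, Equiv.trans_apply, Equiv.sumComm_apply, Sum.swap_inl,
      Sum.swap_inr]
    ring
  have h1 : ((k.factorial * l.factorial : ℕ) : ℝ) * ((m.factorial : ℝ) *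
      extDeriv (fun y => wedge h (α y) (β y)) x v) = 0 := by
    rw [extDeriv, factorial_mul_alternatizeUncurryFin_apply, Finset.mul_sum]
    calc _ = ∑ σ : Equiv.Perm (Fin (m + 1)), ∑ τ : Equiv.Perm (Fin m),
          G (σ * Equiv.Perm.decomposeFin.symm (0, τ)) := by
          refine Finset.sum_congr rfl fun σ _ => ?_
          rw [mul_left_comm, hder, Finset.mul_sum]
          refine Finset.sum_congr rfl fun τ _ => ?_
          simp only [hG, Equiv.Perm.sign_mul, Equiv.Perm.decomposeFin.symm_sign, if_true, one_mul,
            Equiv.Perm.mul_apply, Equiv.Perm.decomposeFin_symm_apply_zero,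
            Equiv.Perm.decomposeFin_symm_apply_succ, Equiv.swap_self, Equiv.refl_apply]
          push_cast
          ring
      _ = ∑ τ : Equiv.Perm (Fin m), ∑ σ, G σ := by
          rw [Finset.sum_comm]
          exact Finset.sum_congr rfl fun τ _ => Equiv.sum_comp (Equiv.mulRight _) G
      _ = 0 := by simp [hG0]
  have hk : ((k.factorial * l.factorial : ℕ) : ℝ) ≠ 0 := by
    exact_mod_cast mul_ne_zero (Nat.factorial_ne_zero k) (Nat.factorial_ne_zero l)
  have hm : (m.factorial : ℝ) ≠ 0 := by exact_mod_cast Nat.factorial_ne_zero m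
  exact (mul_eq_zero.mp ((mul_eq_zero.mp h1).resolve_left hk)).resolve_left hm

end Smoothness

/-! ### Forms on the torus and on `ℝ³` -/

section ManifoldPullback

variable {n n' n'' k : ℕ}
  {M : Type*} [TopologicalSpace M] [ChartedSpace (E n) M]
  {N : Type*} [TopologicalSpace N] [ChartedSpace (E n') N]
  {L : Type*} [TopologicalSpace L] [ChartedSpace (E n'') L]

theorem pullback_comp {g : N → L} {f : M → N} {x : M} (Θ : Form n'' L k)
    (hg : MDifferentiableAt (𝓡 n') (𝓡 n'') g (f x)) (hf : MDifferentiableAt (𝓡 n) (𝓡 n') f x) :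
    pullback (n := n) (g ∘ f) Θ x =
      (pullback (n := n') g Θ (f x)).compContinuousLinearMap (mfderiv (𝓡 n) (𝓡 n') f x) := by
  ext v
  simp only [pullback, mfderiv_comp x hg hf]
  rfl

theorem pullback_congr {g g' : M → N} {x : M} (Θ : Form n' N k) (h : g =ᶠ[𝓝 x] g') :
    pullback (n := n) g Θ x = pullback (n := n) g' Θ x := by
  let Θ' : N → E n' [⋀^Fin k]→L[ℝ] ℝ := Θ
  have h1 : (mfderiv (𝓡 n) (𝓡 n') g x : E n →L[ℝ] E n') = mfderiv (𝓡 n) (𝓡 n') g' x :=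
    h.mfderiv_eq
  change (Θ' (g x)).compContinuousLinearMap (mfderiv (𝓡 n) (𝓡 n') g x : E n →L[ℝ] E n') =
    (Θ' (g' x)).compContinuousLinearMap (mfderiv (𝓡 n) (𝓡 n') g' x : E n →L[ℝ] E n')
  rw [h1, h.eq_of_nhds]

end ManifoldPullback

section Torus

theorem chartAt_symm_eq_toTorus (p : Torus) (y : E 3) :
    (chartAt (E 3) p).symm y = toTorus y := by
  obtain ⟨q, hq⟩ : ∃ q, chartAt (E 3) p =
      (isLocalHomeomorph_toTorus.localInverseAt q).trans (chartAt (E 3) q) := ⟨_, rfl⟩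
  rw [hq]
  simp [chartAt_self_eq (H := E 3)]

theorem toTorus_chartAt {p q : Torus} (hq : q ∈ (chartAt (E 3) p).source) :
    toTorus (chartAt (E 3) p q) = q := by
  rw [← chartAt_symm_eq_toTorus, (chartAt (E 3) p).left_inv hq]

theorem toTorus_add_of_mem {v z : E 3} (hz : z ∈ lattice) : toTorus (v + z) = toTorus v :=
  toTorus_eq_iff.mpr (by simpa using lattice.neg_mem hz)

theorem toTorus_neg (v : E 3) : toTorus (-v) = -toTorus v := rfl

/-- Every point of `ℝ³` is a lattice translate of a point at which `toTorus` agrees with the inverse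
of a chart of the torus. -/
theorem exists_lattice_add_mem_target (v : E 3) :
    ∃ (p : Torus) (z : E 3), z ∈ lattice ∧ v + z ∈ (chartAt (E 3) p).target := by
  refine ⟨toTorus v, chartAt (E 3) (toTorus v) (toTorus v) - v, ?_, ?_⟩
  · rw [← toTorus_eq_iff, toTorus_chartAt (mem_chart_source _ _)]
  · rw [add_sub_cancel]
    exact mem_chart_target _ _

theorem contMDiff_toTorus : ContMDiff (𝓡 3) (𝓡 3) ∞ toTorus := by
  intro v
  obtain ⟨p, z, hz, hv⟩ := exists_lattice_add_mem_target v
  have h1 : ContMDiffAt (𝓡 3) (𝓡 3) ∞ toTorus (v + z) :=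
    ((contMDiffOn_chart_symm (I := 𝓡 3) (n := ∞) (x := p)).contMDiffAt
      ((chartAt (E 3) p).open_target.mem_nhds hv)).congr_of_eventuallyEq
      (.of_forall fun y => (chartAt_symm_eq_toTorus p y).symm)
  have h2 : ContMDiffAt (𝓡 3) (𝓡 3) ∞ (fun w : E 3 => w + z) v :=
    (contDiff_id.add contDiff_const).contMDiff v
  exact (h1.comp v h2).congr_of_eventuallyEq (.of_forall fun w => (toTorus_add_of_mem hz).symm)

theorem mdifferentiableAt_toTorus (v : E 3) : MDifferentiableAt (𝓡 3) (𝓡 3) toTorus v :=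
  (contMDiff_toTorus v).mdifferentiableAt (by simp)

theorem mdifferentiableAt_neg_torus (p : Torus) :
    MDifferentiableAt (𝓡 3) (𝓡 3) (fun x : Torus => -x) p := by
  have h1 : MDifferentiableAt (𝓡 3) (𝓡 3) (chartAt (E 3) p) p :=
    mdifferentiableAt_atlas (chart_mem_atlas _ p) (mem_chart_source _ p)
  have h2 : MDifferentiableAt (𝓡 3) (𝓡 3) (fun v : E 3 => -v) (chartAt (E 3) p p) :=
    (contDiff_neg (n := 1) (𝕜 := ℝ) (F := E 3)).contMDiff.mdifferentiableAt (by simp)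
  have h3 := ((mdifferentiableAt_toTorus _).comp (chartAt (E 3) p p) h2).comp p h1
  refine h3.congr_of_eventuallyEq ?_
  filter_upwards [(chartAt (E 3) p).open_source.mem_nhds (mem_chart_source _ p)] with q hq
  simp [toTorus_neg, toTorus_chartAt hq]

variable {l : ℕ}

/-- The pullback of a form on the torus to `ℝ³`. -/
def liftForm (Θ : Form 3 Torus l) : E 3 → E 3 [⋀^Fin l]→L[ℝ] ℝ := pullback (n := 3) toTorus Θ

/-- The forms on `ℝ³` that come from closed smooth `{±1}`-invariant forms on the torus: closed
smooth forms invariant under the lattice translations and under `v ↦ -v`. -/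
structure IsCrystalForm (θ : E 3 → E 3 [⋀^Fin l]→L[ℝ] ℝ) : Prop where
  contDiff : ContDiff ℝ ∞ θ
  closed : ∀ v, extDeriv θ v = 0
  periodic : ∀ v, ∀ z ∈ lattice, θ (v + z) = θ v
  even : ∀ v, (θ (-v)).compContinuousLinearMap (-ContinuousLinearMap.id ℝ (E 3)) = θ v

theorem liftForm_periodic (Θ : Form 3 Torus l) (v z : E 3) (hz : z ∈ lattice) :
    liftForm Θ (v + z) = liftForm Θ v := by
  have h2 : MDifferentiableAt (𝓡 3) (𝓡 3) (fun w : E 3 => w + z) v :=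
    ((contDiff_id.add contDiff_const).contMDiff (n := 1) v).mdifferentiableAt (by simp)
  have h1 := pullback_comp (x := v) (f := fun w : E 3 => w + z) Θ
    (mdifferentiableAt_toTorus (v + z)) h2
  have h3 : toTorus ∘ (fun w : E 3 => w + z) = toTorus := funext fun w => toTorus_add_of_mem hz
  rw [h3, mfderiv_eq_fderiv] at h1
  rw [liftForm, h1]
  ext w
  simp
  rfl

theorem liftForm_eq_inChart (Θ : Form 3 Torus l) (p : Torus) : liftForm Θ = inChart Θ p :=
  funext fun _ => pullback_congr Θ (.of_forall fun y => (chartAt_symm_eq_toTorus p y).symm)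

theorem isCrystalForm_liftForm {Θ : Form 3 Torus l} (hΘ : IsSmoothForm Θ) (hΘ' : IsClosedForm Θ)
    (hinv : IsInvariantForm Θ) : IsCrystalForm (liftForm Θ) where
  contDiff := by
    refine contDiff_iff_contDiffAt.mpr fun v => ?_
    obtain ⟨p, z, hz, hv⟩ := exists_lattice_add_mem_target v
    have h1 : ContDiffAt ℝ ∞ (liftForm Θ) (v + z) :=
      liftForm_eq_inChart Θ p ▸ (hΘ p).contDiffAt ((chartAt (E 3) p).open_target.mem_nhds hv)
    have h2 := h1.comp v (contDiff_id.add contDiff_const).contDiffAt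
    exact h2.congr_of_eventuallyEq (.of_forall fun w => (liftForm_periodic Θ w z hz).symm)
  closed v := by
    obtain ⟨p, z, hz, hv⟩ := exists_lattice_add_mem_target v
    have h1 : extDeriv (liftForm Θ) (v + z) = 0 :=
      liftForm_eq_inChart Θ p ▸ hΘ' p _ hv
    have h2 : fderiv ℝ (liftForm Θ) (v + z) = fderiv ℝ (liftForm Θ) v := by
      rw [← fderiv_comp_add_right]
      congr 1
      exact funext fun w => liftForm_periodic Θ w z hz
    rw [extDeriv, ← h2]
    exact h1
  periodic := liftForm_periodic Θ
  even v := by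
    let Θ' : Torus → E 3 [⋀^Fin l]→L[ℝ] ℝ := Θ
    have h2 : MDifferentiableAt (𝓡 3) (𝓡 3) (fun v : E 3 => -v) v :=
      (contDiff_neg (n := 1) (𝕜 := ℝ) (F := E 3)).contMDiff.mdifferentiableAt (by simp)
    have h3 := pullback_comp (x := v) (f := fun w : E 3 => -w) Θ (mdifferentiableAt_toTorus (-v)) h2
    have h4 := pullback_comp (x := v) (f := toTorus) Θ (mdifferentiableAt_neg_torus _)
      (mdifferentiableAt_toTorus v)
    have h5 : toTorus ∘ (fun w : E 3 => -w) = (fun x : Torus => -x) ∘ toTorus := rfl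
    rw [hinv] at h4
    rw [h5, h4, mfderiv_eq_fderiv] at h3
    refine Eq.trans ?_ h3.symm
    congr 1
    exact (fderiv_fun_neg (f := fun w : E 3 => w)).trans (by simp) |>.symm

theorem isClosed_lattice : IsClosed (lattice : Set (E 3)) :=
  AddSubgroup.isClosed_of_discrete

end Torus

/-! ### Pulling back along maps to `T³ / {±1}` -/

section OrbifoldPullback

variable {W W' : Type*} [NormedAddCommGroup W] [NormedSpace ℝ W] [NormedAddCommGroup W']
  [NormedSpace ℝ W'] {l : ℕ} {θ : E 3 → E 3 [⋀^Fin l]→L[ℝ] ℝ} {f : W → QuotientTorus}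
  {U U' : Set W} {u u' : W → E 3} {w : W}

/-- The pullback of a form on `ℝ³` by a map from a normed space. -/
def pull (u : W → E 3) (θ : E 3 → E 3 [⋀^Fin l]→L[ℝ] ℝ) (w : W) : W [⋀^Fin l]→L[ℝ] ℝ :=
  (θ (u w)).compContinuousLinearMap (fderiv ℝ u w)

theorem pull_congr (h : u =ᶠ[𝓝 w] u') : pull u θ w = pull u' θ w := by
  rw [pull, pull, h.eq_of_nhds, h.fderiv_eq]

theorem contDiffAt_pull [FiniteDimensional ℝ W] (hθ : ContDiff ℝ ∞ θ) (hu : ContDiffAt ℝ ∞ u w) :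
    ContDiffAt ℝ ∞ (pull u θ) w :=
  contDiffAt_compContinuousLinearMap (hθ.contDiffAt.comp w hu) (hu.fderiv_right (by simp))

theorem extDeriv_pull_eq_zero (hθ : IsCrystalForm θ) (hu : ContDiffAt ℝ ∞ u w) :
    extDeriv (pull u θ) w = 0 := by
  have h := extDeriv_pullback (hθ.contDiff.differentiable (by simp) (u w)) hu
    (by simpa using ENat.LEInfty.out)
  rw [hθ.closed] at h
  exact h

/-- `u` is a smooth lift of `f : W → T³ / {±1}` to `ℝ³` on the open set `U`. -/
structure IsEuclideanLift (f : W → QuotientTorus) (U : Set W) (u : W → E 3) : Prop where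
  isOpen : IsOpen U
  contDiffOn : ContDiffOn ℝ ∞ u U
  proj_eq : ∀ w ∈ U, proj (toTorus (u w)) = f w

theorem IsEuclideanLift.contDiffAt (h : IsEuclideanLift f U u) (hw : w ∈ U) :
    ContDiffAt ℝ ∞ u w := h.contDiffOn.contDiffAt (h.isOpen.mem_nhds hw)

theorem IsEuclideanLift.sub_mem_or_add_mem (h : IsEuclideanLift f U u)
    (h' : IsEuclideanLift f U' u') (hw : w ∈ U) (hw' : w ∈ U') :
    u' w - u w ∈ lattice ∨ u' w + u w ∈ lattice := by
  rcases proj_eq_iff.mp ((h.proj_eq w hw).trans (h'.proj_eq w hw').symm) with h1 | h1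
  · exact .inl (toTorus_eq_iff.mp h1)
  · rw [← toTorus_neg, toTorus_eq_iff] at h1
    exact .inr (by simpa [add_comm] using lattice.neg_mem h1)

/-- A continuous map with values in the lattice is locally constant. -/
theorem eventually_eq_of_forall_mem_lattice {X : Type*} [TopologicalSpace X] {w : X}
    {d : X → E 3} (hd : ContinuousAt d w) (h : ∀ᶠ y in 𝓝 w, d y ∈ lattice) :
    ∀ᶠ y in 𝓝 w, d y = d w := by
  filter_upwards [h, Metric.continuousAt_iff'.mp hd 1 one_pos] with y hy hdist
  rw [dist_eq_norm] at hdist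
  exact sub_eq_zero.mp (eq_zero_of_mem_lattice (lattice.sub_mem hy h.self_of_nhds) hdist)

/-- If two lifts differ by a lattice valued map near `w`, they pull back `θ` to the same form. -/
theorem pull_eq_of_sub_mem (hθ : IsCrystalForm θ) (hu : ContinuousAt u w) (hu' : ContinuousAt u' w)
    (h : ∀ᶠ y in 𝓝 w, u' y - u y ∈ lattice) : pull u' θ w = pull u θ w := by
  have h1 : u' =ᶠ[𝓝 w] fun y => u y + (u' w - u w) := by
    filter_upwards [eventually_eq_of_forall_mem_lattice (hu'.sub hu) h] with y hy
    simp only [Pi.sub_apply] at hy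
    rw [← hy]; simp
  rw [pull_congr h1, pull, pull, fderiv_add_const, hθ.periodic _ _ h.self_of_nhds]

theorem pull_neg (hθ : IsCrystalForm θ) (u : W → E 3) : pull (-u) θ w = pull u θ w := by
  rw [pull, pull, fderiv_neg, Pi.neg_apply, ← hθ.even (u w)]
  rfl

/-- The pullback of `θ` by a lift does not depend on the lift: near a dense set of points two lifts
agree up to sign and lattice translation, and both pullbacks are continuous. -/
theorem IsEuclideanLift.pull_eq [FiniteDimensional ℝ W] (hθ : IsCrystalForm θ)
    (h : IsEuclideanLift f U u) (h' : IsEuclideanLift f U' u') (hw : w ∈ U) (hw' : w ∈ U') :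
    pull u θ w = pull u' θ w := by
  have hcu : ∀ y ∈ U ∩ U', ContinuousAt u y := fun y hy => (h.contDiffAt hy.1).continuousAt
  have hcu' : ∀ y ∈ U ∩ U', ContinuousAt u' y := fun y hy => (h'.contDiffAt hy.2).continuousAt
  have hS : ∀ y ∈ U ∩ U', ∀ᶠ z in 𝓝 y, z ∈ U ∩ U' := fun y hy =>
    (h.isOpen.inter h'.isOpen).mem_nhds hy
  by_contra hne
  have hev : ∀ᶠ y in 𝓝 w, pull u θ y ≠ pull u' θ y := by
    by_contra hfreq
    exact hne (tendsto_nhds_unique_of_frequently_eq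
      (contDiffAt_pull hθ.contDiff (h.contDiffAt hw)).continuousAt
      (contDiffAt_pull hθ.contDiff (h'.contDiffAt hw')).continuousAt hfreq)
  -- near `w` the first alternative fails on every open set, so the second one, which is a closed
  -- condition, holds at every point
  have hB : ∀ᶠ y in 𝓝 w, u' y + u y ∈ lattice := by
    filter_upwards [hev, hS w ⟨hw, hw'⟩] with y hy hyS
    by_contra hyB
    have h1 : ∀ᶠ z in 𝓝 y, u' z + u z ∉ lattice :=
      ((hcu' y hyS).add (hcu y hyS)).eventually (isClosed_lattice.isOpen_compl.mem_nhds hyB)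
    refine hy (pull_eq_of_sub_mem hθ (hcu y hyS) (hcu' y hyS) ?_).symm
    filter_upwards [h1, hS y hyS] with z hz hzS
    exact (h.sub_mem_or_add_mem h' hzS.1 hzS.2).resolve_right hz
  refine hne ?_
  rw [← pull_neg hθ u]
  refine (pull_eq_of_sub_mem hθ (hcu w ⟨hw, hw'⟩).neg (hcu' w ⟨hw, hw'⟩) ?_).symm
  simpa using hB

open Classical in
/-- The pullback `f^*θ` of a form `θ` as in `IsCrystalForm` by a map `f : W → T³ / {±1}`, computed
with an arbitrary lift of `f` near each point (and `0` at the points without lifts). -/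
def orbPull (θ : E 3 → E 3 [⋀^Fin l]→L[ℝ] ℝ) (f : W → QuotientTorus) (w : W) :
    W [⋀^Fin l]→L[ℝ] ℝ :=
  if h : ∃ (U : Set W) (u : W → E 3), w ∈ U ∧ IsEuclideanLift f U u then
    pull h.choose_spec.choose θ w else 0

theorem IsEuclideanLift.orbPull_eq [FiniteDimensional ℝ W] (hθ : IsCrystalForm θ)
    (h : IsEuclideanLift f U u) (hw : w ∈ U) : orbPull θ f w = pull u θ w := by
  have hex : ∃ (U : Set W) (u : W → E 3), w ∈ U ∧ IsEuclideanLift f U u := ⟨U, u, hw, h⟩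
  rw [orbPull, dif_pos hex]
  exact hex.choose_spec.choose_spec.2.pull_eq hθ h hex.choose_spec.choose_spec.1 hw

theorem IsEuclideanLift.orbPull_eventuallyEq [FiniteDimensional ℝ W] (hθ : IsCrystalForm θ)
    (h : IsEuclideanLift f U u) (hw : w ∈ U) : orbPull θ f =ᶠ[𝓝 w] pull u θ :=
  Filter.eventuallyEq_of_mem (h.isOpen.mem_nhds hw) fun _ hy => h.orbPull_eq hθ hy

theorem IsEuclideanLift.contDiffAt_orbPull [FiniteDimensional ℝ W] (hθ : IsCrystalForm θ)
    (h : IsEuclideanLift f U u) (hw : w ∈ U) : ContDiffAt ℝ ∞ (orbPull θ f) w :=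
  (contDiffAt_pull hθ.contDiff (h.contDiffAt hw)).congr_of_eventuallyEq
    (h.orbPull_eventuallyEq hθ hw)

theorem IsEuclideanLift.extDeriv_orbPull [FiniteDimensional ℝ W] (hθ : IsCrystalForm θ)
    (h : IsEuclideanLift f U u) (hw : w ∈ U) : extDeriv (orbPull θ f) w = 0 :=
  (h.orbPull_eventuallyEq hθ hw).extDeriv_eq.trans (extDeriv_pull_eq_zero hθ (h.contDiffAt hw))

theorem IsEuclideanLift.comp (h : IsEuclideanLift f U u) {τ : W' → W} {S : Set W'} (hS : IsOpen S)
    (hτ : ContDiffOn ℝ ∞ τ S) {f' : W' → QuotientTorus} (hf' : ∀ y ∈ S, f' y = f (τ y)) :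
    IsEuclideanLift f' (S ∩ τ ⁻¹' U) (u ∘ τ) where
  isOpen := hτ.continuousOn.isOpen_inter_preimage hS h.isOpen
  contDiffOn := h.contDiffOn.comp (hτ.mono inter_subset_left) fun _ hy => hy.2
  proj_eq y hy := (h.proj_eq _ hy.2).trans (hf' y hy.1).symm

/-- Naturality of the pullback under smooth maps. -/
theorem IsEuclideanLift.orbPull_comp [FiniteDimensional ℝ W] [FiniteDimensional ℝ W']
    (hθ : IsCrystalForm θ) (h : IsEuclideanLift f U u) {τ : W' → W} {S : Set W'} (hS : IsOpen S)
    (hτ : ContDiffOn ℝ ∞ τ S) {f' : W' → QuotientTorus} (hf' : ∀ y ∈ S, f' y = f (τ y)) {y : W'}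
    (hy : y ∈ S) (hyU : τ y ∈ U) :
    orbPull θ f' y = (orbPull θ f (τ y)).compContinuousLinearMap (fderiv ℝ τ y) := by
  rw [h.orbPull_eq hθ hyU, (h.comp hS hτ hf').orbPull_eq hθ ⟨hy, hyU⟩, pull, pull,
    fderiv_comp y ((h.contDiffAt hyU).differentiableAt (by simp))
      ((hτ.contDiffAt (hS.mem_nhds hy)).differentiableAt (by simp))]
  rfl

/-- A smooth map to the torus lifts locally to `ℝ³`. -/
theorem exists_euclidean_lift {g : W → Torus} (hU : IsOpen U)
    (hg : ContMDiffOn 𝓘(ℝ, W) (𝓡 3) ∞ g U) (hw : w ∈ U) :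
    ∃ (U' : Set W) (u : W → E 3), w ∈ U' ∧ U' ⊆ U ∧ IsOpen U' ∧ ContDiffOn ℝ ∞ u U' ∧
      ∀ y ∈ U', toTorus (u y) = g y := by
  refine ⟨U ∩ g ⁻¹' (chartAt (E 3) (g w)).source, chartAt (E 3) (g w) ∘ g,
    ⟨hw, mem_chart_source (E 3) (g w)⟩, inter_subset_left,
    hg.continuousOn.isOpen_inter_preimage hU (chartAt (E 3) (g w)).open_source, ?_,
    fun y hy => toTorus_chartAt hy.2⟩
  rw [← contMDiffOn_iff_contDiffOn]
  exact (contMDiffOn_chart (I := 𝓡 3) (n := ∞) (x := g w)).comp (hg.mono inter_subset_left)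
    fun y hy => hy.2

end OrbifoldPullback

section Chart

variable {m k l : ℕ} {M : Type*} [TopologicalSpace M] [ChartedSpace (E m) M]
  [IsManifold (𝓡 m) ∞ M] {Θ : Form 3 Torus l} {f : M → QuotientTorus} {U : Set M} {g : M → Torus}

theorem contMDiffAt_chart_symm {c : M} {y : E m} (hy : y ∈ (chartAt (E m) c).target) :
    ContMDiffAt (𝓡 m) (𝓡 m) ∞ (chartAt (E m) c).symm y :=
  (contMDiffOn_chart_symm (I := 𝓡 m) (n := ∞) (x := c)).contMDiffAt
    ((chartAt (E m) c).open_target.mem_nhds hy)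

/-- In a chart, lifts to the torus give rise to lifts to `ℝ³`. -/
theorem IsSmoothLift.exists_euclideanLift (h : IsSmoothLift (𝓡 m) f U g) {c : M} {y : E m}
    (hy : y ∈ (chartAt (E m) c).target) (hyU : (chartAt (E m) c).symm y ∈ U) :
    ∃ (U' : Set (E m)) (u : E m → E 3), y ∈ U' ∧
      IsEuclideanLift (f ∘ (chartAt (E m) c).symm) U' u ∧
      ∀ z ∈ U', toTorus (u z) = g ((chartAt (E m) c).symm z) := by
  set e := chartAt (E m) c
  have hS : IsOpen (e.target ∩ e.symm ⁻¹' U) := e.isOpen_inter_preimage_symm h.isOpen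
  have hg : ContMDiffOn (𝓡 m) (𝓡 3) ∞ (g ∘ e.symm) (e.target ∩ e.symm ⁻¹' U) :=
    h.contMDiffOn.comp ((contMDiffOn_chart_symm (I := 𝓡 m) (n := ∞) (x := c)).mono
      inter_subset_left) fun z hz => hz.2
  obtain ⟨U', u, hyU', hU', hopen, hu, hlift⟩ := exists_euclidean_lift hS hg ⟨hy, hyU⟩
  exact ⟨U', u, hyU', ⟨hopen, hu, fun z hz => by
    rw [hlift z hz]; exact h.proj_eq _ (hU' hz).2⟩, hlift⟩

theorem IsSmoothLift.inChart_pullback (hθ : IsCrystalForm (liftForm Θ))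
    (h : IsSmoothLift (𝓡 m) f U g) {c : M} {y : E m}
    (hy : y ∈ (chartAt (E m) c).target) (hyU : (chartAt (E m) c).symm y ∈ U) :
    inChart (pullback (n := m) g Θ) c y =
      orbPull (liftForm Θ) (f ∘ (chartAt (E m) c).symm) y := by
  obtain ⟨U', u, hyU', hu, hlift⟩ := h.exists_euclideanLift hy hyU
  have h1 : toTorus ∘ u =ᶠ[𝓝 y] g ∘ (chartAt (E m) c).symm :=
    Filter.eventuallyEq_of_mem (hu.isOpen.mem_nhds hyU') hlift
  have hg : MDifferentiableAt (𝓡 m) (𝓡 3) g ((chartAt (E m) c).symm y) :=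
    (h.contMDiffOn.contMDiffAt (h.isOpen.mem_nhds hyU)).mdifferentiableAt (by simp)
  have hu' : MDifferentiableAt (𝓡 m) (𝓡 3) u y :=
    (hu.contDiffAt hyU').contMDiffAt.mdifferentiableAt (by simp)
  have h2 := pullback_comp Θ hg ((contMDiffAt_chart_symm hy).mdifferentiableAt (by simp))
  have h3 := pullback_comp Θ (mdifferentiableAt_toTorus (u y)) hu'
  rw [hu.orbPull_eq hθ hyU', pull, ← mfderiv_eq_fderiv]
  exact h2.symm.trans ((pullback_congr Θ h1).symm.trans h3)

/-- A form is determined at a point by its expression in a chart. -/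
theorem eq_inChart_compContinuousLinearMap (α : Form m M k) {c x : M}
    (hx : x ∈ (chartAt (E m) c).source) :
    α x = (inChart α c (chartAt (E m) c x)).compContinuousLinearMap
      (mfderiv (𝓡 m) (𝓡 m) (chartAt (E m) c) x) := by
  have hd := mdifferentiable_chart (I := 𝓡 m) c
  have h1 := pullback_comp (x := x) α (hd.mdifferentiableAt_symm ((chartAt (E m) c).map_source hx))
    (hd.mdifferentiableAt hx)
  have h2 : (chartAt (E m) c).symm ∘ (chartAt (E m) c) =ᶠ[𝓝 x] id :=
    Filter.eventuallyEq_of_mem ((chartAt (E m) c).open_source.mem_nhds hx)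
      fun z hz => (chartAt (E m) c).left_inv hz
  refine Eq.trans ?_ h1
  rw [pullback_congr α h2]
  ext v
  simp only [pullback, mfderiv_id]
  rfl

theorem inChart_orbifoldPullback (hθ : IsCrystalForm (liftForm Θ))
    (hf : IsSmoothOrbifoldMap (𝓡 m) f) {c : M} {y : E m} (hy : y ∈ (chartAt (E m) c).target) :
    inChart (orbifoldPullback hf Θ) c y =
      orbPull (liftForm Θ) (f ∘ (chartAt (E m) c).symm) y := by
  have h := (hf.exists_lift ((chartAt (E m) c).symm y)).choose_spec.choose_spec
  exact h.2.inChart_pullback hθ hy h.1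

/-- The pullback of an invariant form may be computed with any local lift. -/
theorem orbifoldPullback_eq_pullback (hθ : IsCrystalForm (liftForm Θ))
    (hf : IsSmoothOrbifoldMap (𝓡 m) f) (h : IsSmoothLift (𝓡 m) f U g) {x : M} (hx : x ∈ U) :
    orbifoldPullback hf Θ x = pullback (n := m) g Θ x := by
  have hxc := mem_chart_source (E m) x
  have hy := mem_chart_target (E m) x
  rw [eq_inChart_compContinuousLinearMap (orbifoldPullback hf Θ) hxc,
    eq_inChart_compContinuousLinearMap (pullback (n := m) g Θ) hxc,
    inChart_orbifoldPullback hθ hf hy, h.inChart_pullback hθ hy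
      (by rwa [(chartAt (E m) x).left_inv hxc])]

theorem isSmoothForm_orbifoldPullback (hθ : IsCrystalForm (liftForm Θ))
    (hf : IsSmoothOrbifoldMap (𝓡 m) f) : IsSmoothForm (orbifoldPullback hf Θ) := by
  intro c y hy
  obtain ⟨U, g, hyU, h⟩ := hf.exists_lift ((chartAt (E m) c).symm y)
  obtain ⟨U', u, hyU', hu, -⟩ := h.exists_euclideanLift hy hyU
  exact ((hu.contDiffAt_orbPull hθ hyU').contDiffWithinAt).congr
    (fun z hz => inChart_orbifoldPullback hθ hf hz) (inChart_orbifoldPullback hθ hf hy)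

end Chart

/-! ### Stokes' theorem and change of variables -/

section Stokes

variable {m : ℕ}

theorem integral_fderiv_eq_zero {g : E m → ℝ} (hg : ContDiff ℝ 1 g) (hc : HasCompactSupport g)
    (v : E m) : ∫ y, fderiv ℝ g y v = 0 := by
  have hc' : HasCompactSupport fun y => fderiv ℝ g y v := hc.fderiv_apply (𝕜 := ℝ) v
  have hcont : Continuous fun y => fderiv ℝ g y v :=
    (hg.continuous_fderiv (by simp)).clm_apply continuous_const
  have h := integral_mul_fderiv_eq_neg_fderiv_mul_of_integrable (μ := volume) (v := v)
    (f := fun _ : E m => (1 : ℝ)) (g := g) (by simp)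
    (by simpa using hcont.integrable_of_hasCompactSupport hc')
    (by simpa using hg.continuous.integrable_of_hasCompactSupport hc)
    (fun _ _ => differentiableAt_const _) (fun _ _ => (hg.differentiable (by simp)) _)
  simpa using h

/-- The frame `(0, e₁), …, (0, e_m)` of the slices `{t} × ℝᵐ`. -/
def sliceFrame (m : ℕ) : Fin m → ℝ × E m := fun i => (0, stdFrame m i)

/-- The frame `(1, 0), (0, e₁), …, (0, e_m)` of `ℝ × ℝᵐ`. -/
def spacetimeFrame (m : ℕ) : Fin (m + 1) → ℝ × E m := Fin.cons (1, 0) (sliceFrame m)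

/-- Stokes' theorem on `ℝ × ℝᵐ`, in differential form: if `ν` is an `m`-form supported in `ℝ × K`
with `K` compact, then the derivative of the integral of `ν` over `{t} × ℝᵐ` is the integral of
`ι_{∂ₜ} dν`. -/
theorem hasDerivAt_integral_sliceFrame {ν : ℝ × E m → (ℝ × E m) [⋀^Fin m]→L[ℝ] ℝ}
    (hν : ContDiff ℝ ∞ ν) {K : Set (E m)} (hK : IsCompact K)
    (hsupp : ∀ t, ∀ y ∉ K, ν (t, y) = 0) (t : ℝ) :
    HasDerivAt (fun t => ∫ y, ν (t, y) (sliceFrame m))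
      (∫ y, extDeriv ν (t, y) (spacetimeFrame m)) t := by
  have hd : ∀ p, DifferentiableAt ℝ ν p := hν.differentiable (by simp)
  have happ : ∀ w, ContDiff ℝ ∞ fun p => ν p w := fun w =>
    contDiff_iff_contDiffAt.mpr fun p =>
      (hν.contDiffAt (x := p)).continuousAlternatingMap_apply fun _ => contDiffAt_const
  have hslice : ∀ w t, ContDiff ℝ ∞ fun y => ν (t, y) w := fun w t =>
    (happ w).comp (contDiff_const.prodMk contDiff_id)
  have hcs : ∀ w t, HasCompactSupport fun y => ν (t, y) w := fun w t =>
    HasCompactSupport.intro hK fun y hy => by rw [hsupp t y hy]; rfl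
  have hfcont : ∀ w u, Continuous fun p => fderiv ℝ (fun q => ν q w) p u := fun w u =>
    ((happ w).continuous_fderiv (by simp)).clm_apply continuous_const
  have hf0 : ∀ w u t, ∀ y ∉ K, fderiv ℝ (fun q => ν q w) (t, y) u = 0 := by
    intro w u t y hy
    have h1 : (fun q => ν q w) =ᶠ[𝓝 (t, y)] fun _ => 0 := by
      filter_upwards [(continuous_snd.tendsto (t, y)).eventually
        (hK.isClosed.isOpen_compl.mem_nhds hy)] with q hq
      rw [hsupp q.1 q.2 hq]; rfl
    rw [h1.fderiv_eq]; simp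
  have hfint : ∀ w u t, Integrable fun y => fderiv ℝ (fun q => ν q w) (t, y) u := fun w u t =>
    ((hfcont w u).comp (continuous_const.prodMk continuous_id)).integrable_of_hasCompactSupport
      (HasCompactSupport.intro hK (hf0 w u t))
  have hder : HasDerivAt (fun t => ∫ y, ν (t, y) (sliceFrame m))
      (∫ y, fderiv ℝ (fun q => ν q (sliceFrame m)) (t, y) (1, 0)) t := by
    obtain ⟨C, hC⟩ :=
      ((isCompact_Icc (a := t - 1) (b := t + 1)).prod hK).exists_bound_of_continuousOn
        (hfcont (sliceFrame m) (1, 0)).continuousOn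
    refine (hasDerivAt_integral_of_dominated_loc_of_deriv_le (μ := volume)
      (bound := K.indicator fun _ => C)
      (F := fun t y => ν (t, y) (sliceFrame m))
      (F' := fun t y => fderiv ℝ (fun q => ν q (sliceFrame m)) (t, y) (1, 0))
      (Icc_mem_nhds (by linarith : t - 1 < t) (by linarith : t < t + 1))
      (.of_forall fun t => (hslice _ t).continuous.aestronglyMeasurable)
      ((hslice _ t).continuous.integrable_of_hasCompactSupport (hcs _ t))
      (hfint _ _ t).aestronglyMeasurable (.of_forall fun y s hs => ?_) ?_
      (.of_forall fun y s hs => ?_)).2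
    · by_cases hy : y ∈ K
      · rw [indicator_of_mem hy]
        exact hC (s, y) ⟨hs, hy⟩
      · rw [indicator_of_notMem hy, hf0 _ _ _ _ hy, norm_zero]
    · exact (integrable_indicator_iff hK.measurableSet).mpr
        (integrableOn_const hK.measure_lt_top.ne)
    · have h1 := ((happ (sliceFrame m)).differentiable (by simp) (s, y)).hasFDerivAt
      exact h1.comp_hasDerivAt s ((hasDerivAt_id s).prodMk (hasDerivAt_const s y))
  convert hder using 1
  have h2 : ∀ y, extDeriv ν (t, y) (spacetimeFrame m) =
      fderiv ℝ (fun q => ν q (sliceFrame m)) (t, y) (1, 0) +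
        ∑ j : Fin m, (-1) ^ (j.succ : ℕ) * fderiv ℝ (fun q => ν q
          (j.succ.removeNth (spacetimeFrame m))) (t, y) (0, stdFrame m j) := by
    intro y
    rw [extDeriv_apply (hd _), Fin.sum_univ_succ]
    have h0 : Fin.removeNth 0 (spacetimeFrame m) = sliceFrame m := by
      ext1 i; simp [Fin.removeNth, spacetimeFrame]
    rw [h0]
    simp [spacetimeFrame, sliceFrame]
  simp only [h2]
  rw [integral_add (hfint _ _ _) (integrable_finsetSum _ fun j _ => (hfint _ _ _).const_mul _),
    integral_finsetSum _ fun j _ => (hfint _ _ _).const_mul _, add_eq_left]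
  refine Finset.sum_eq_zero fun j _ => ?_
  rw [integral_const_mul]
  -- the derivatives in the directions of `ℝᵐ` are derivatives of functions on the slice
  set w : Fin m → ℝ × E m := j.succ.removeNth (spacetimeFrame m)
  have h3 : ∀ y, fderiv ℝ (fun q => ν q w) (t, y) (0, stdFrame m j) =
      fderiv ℝ (fun z => ν (t, z) w) y (stdFrame m j) := by
    intro y
    have h4 := ((happ w).differentiable (by simp) (t, y)).hasFDerivAt.comp y
      ((hasFDerivAt_const t y).prodMk (hasFDerivAt_id y))
    have h5 : fderiv ℝ (fun z => ν (t, z) w) y = _ := h4.fderiv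
    rw [h5]
    rfl
  simp only [h3]
  rw [integral_fderiv_eq_zero ((hslice w t).of_le (by simp)) (hcs w t), mul_zero]

end Stokes

section ChangeOfVariables

variable {m : ℕ} {M : Type*} [TopologicalSpace M] [ChartedSpace (E m) M]

/-- The transition map from the chart around `c` to the chart around `c'`. -/
def transition (c c' : M) : E m → E m := chartAt (E m) c' ∘ (chartAt (E m) c).symm

/-- The domain of definition of the transition map from the chart around `c` to that around `c'`. -/
def overlap (c c' : M) : Set (E m) :=
  (chartAt (E m) c).target ∩ (chartAt (E m) c).symm ⁻¹' (chartAt (E m) c').source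

theorem isOpen_overlap (c c' : M) : IsOpen (overlap (m := m) c c') :=
  (chartAt (E m) c).isOpen_inter_preimage_symm (chartAt (E m) c').open_source

theorem transition_mem_target {c c' : M} {y : E m} (hy : y ∈ overlap c c') :
    transition c c' y ∈ (chartAt (E m) c').target :=
  (chartAt (E m) c').map_source hy.2

theorem chartAt_symm_transition {c c' : M} {y : E m} (hy : y ∈ overlap c c') :
    (chartAt (E m) c').symm (transition c c' y) = (chartAt (E m) c).symm y :=
  (chartAt (E m) c').left_inv hy.2

theorem transition_image_overlap (c c' : M) :
    transition (m := m) c c' '' overlap c c' = overlap c' c := by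
  have h := ((chartAt (E m) c).symm ≫ₕ chartAt (E m) c').image_source_eq_target
  simpa [overlap, transition, OpenPartialHomeomorph.trans_source,
    OpenPartialHomeomorph.trans_target] using h

theorem injOn_transition (c c' : M) : InjOn (transition (m := m) c c') (overlap c c') := by
  have h := ((chartAt (E m) c).symm ≫ₕ chartAt (E m) c').injOn
  simpa [overlap, transition, OpenPartialHomeomorph.trans_source] using h

/-- A top degree form is multiplied by the determinant under a linear substitution. -/
theorem map_stdFrame_eq_det_mul (A : E m →L[ℝ] E m) (f : E m [⋀^Fin m]→L[ℝ] ℝ) :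
    f (fun i => A (stdFrame m i)) = A.det * f (stdFrame m) := by
  let b := (EuclideanSpace.basisFun (Fin m) ℝ).toBasis
  have hb : ∀ i, b i = stdFrame m i := fun i => by
    simp [b, stdFrame, EuclideanSpace.basisFun_apply]
  have h1 := f.toAlternatingMap.eq_smul_basis_det b
  have h2 : f (fun i => A (stdFrame m i)) = f.toAlternatingMap b * b.det (A ∘ b) := by
    have := congrArg (fun g => g (fun i => A (stdFrame m i))) h1
    refine this.trans ?_
    simp only [AlternatingMap.smul_apply, smul_eq_mul]
    congr 2
    ext1 i
    simp [hb]
  have h3 : f.toAlternatingMap b = f (stdFrame m) := by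
    rw [show (⇑b : Fin m → E m) = stdFrame m from funext hb]; rfl
  rw [h2, h3, mul_comm]
  congr 1
  have := b.det_comp (A : E m →ₗ[ℝ] E m) b
  rw [b.det_self, mul_one] at this
  exact this

variable [IsManifold (𝓡 m) ∞ M]

theorem contDiffOn_transition (c c' : M) :
    ContDiffOn ℝ ∞ (transition (m := m) c c') (overlap c c') := by
  rw [← contMDiffOn_iff_contDiffOn]
  exact (contMDiffOn_chart (I := 𝓡 m) (n := ∞) (x := c')).comp
    ((contMDiffOn_chart_symm (I := 𝓡 m) (n := ∞) (x := c)).mono inter_subset_left)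
    fun y hy => hy.2

/-- Densities on `M` (given by their coordinate expressions `D` and `D'` in two charts) that vanish
outside the intersection of the chart domains have the same integral in both charts. -/
theorem setIntegral_eq_of_transition {c c' : M} {D D' : E m → ℝ}
    (hD : ∀ y ∈ (chartAt (E m) c).target, (chartAt (E m) c).symm y ∉ (chartAt (E m) c').source →
      D y = 0)
    (hD' : ∀ y ∈ (chartAt (E m) c').target, (chartAt (E m) c').symm y ∉ (chartAt (E m) c).source →
      D' y = 0)
    (h : ∀ y ∈ overlap c c', D y = |(fderiv ℝ (transition c c') y).det| * D' (transition c c' y)) :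
    ∫ y in (chartAt (E m) c).target, D y = ∫ y in (chartAt (E m) c').target, D' y := by
  have h1 : ∫ y in (chartAt (E m) c).target, D y = ∫ y in overlap c c', D y :=
    setIntegral_eq_of_subset_of_forall_sdiff_eq_zero (chartAt (E m) c).open_target.measurableSet
      inter_subset_left fun y hy => hD y hy.1 fun hy' => hy.2 ⟨hy.1, hy'⟩
  have h2 : ∫ y in (chartAt (E m) c').target, D' y = ∫ y in overlap c' c, D' y :=
    setIntegral_eq_of_subset_of_forall_sdiff_eq_zero (chartAt (E m) c').open_target.measurableSet
      inter_subset_left fun y hy => hD' y hy.1 fun hy' => hy.2 ⟨hy.1, hy'⟩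
  rw [h1, h2, ← transition_image_overlap c c',
    integral_image_eq_integral_abs_det_fderiv_smul volume (isOpen_overlap c c').measurableSet
      (fun y hy => (((contDiffOn_transition c c').contDiffAt
        ((isOpen_overlap c c').mem_nhds hy)).differentiableAt
          (by simp)).hasFDerivAt.hasFDerivWithinAt) (injOn_transition c c')]
  exact setIntegral_congr_fun (isOpen_overlap c c').measurableSet h

theorem inChart_transition {k : ℕ} (α : Form m M k) {c c' : M} {y : E m} (hy : y ∈ overlap c c') :
    inChart α c y = (inChart α c' (transition c c' y)).compContinuousLinearMap
      (fderiv ℝ (transition c c') y) := by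
  have hd := mdifferentiable_chart (I := 𝓡 m) c'
  have h0 : DifferentiableAt ℝ (transition c c') y :=
    ((contDiffOn_transition c c').contDiffAt ((isOpen_overlap c c').mem_nhds hy)).differentiableAt
      (by simp)
  have h1 := pullback_comp (x := y) (f := transition c c') α
    (hd.mdifferentiableAt_symm (transition_mem_target hy)) h0.mdifferentiableAt
  rw [mfderiv_eq_fderiv] at h1
  refine Eq.trans ?_ h1
  refine pullback_congr α (Filter.eventuallyEq_of_mem ((isOpen_overlap c c').mem_nhds hy) ?_)
  exact fun z hz => (chartAt_symm_transition hz).symm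

theorem inChart_transition_stdFrame (α : Form m M m) {c c' : M} {y : E m}
    (hy : y ∈ overlap c c') : inChart α c y (stdFrame m) =
      (fderiv ℝ (transition c c') y).det * inChart α c' (transition c c' y) (stdFrame m) := by
  rw [inChart_transition α hy]
  exact map_stdFrame_eq_det_mul (fderiv ℝ (transition c c') y) (inChart α c' (transition c c' y))

end ChangeOfVariables

/-! ### The form `α ∧ F^*Θ` on `ℝ × M` -/

section ConormalWedge

variable {m : ℕ}

/-- `ι_{∂ₜ} (L ∧ ν)` evaluated on the standard frame of `ℝᵐ`, for a covector `L` on `ℝᵐ` and an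
`m`-form `ν` on `ℝ × ℝᵐ`. -/
def conormalWedge (L : E m →L[ℝ] ℝ) (ν : (ℝ × E m) [⋀^Fin m]→L[ℝ] ℝ) : ℝ :=
  ContinuousAlternatingMap.alternatizeUncurryFin
    ((L ∘L ContinuousLinearMap.snd ℝ ℝ (E m)).smulRight ν) (spacetimeFrame m)

theorem conormalWedge_eq_sum (L : E m →L[ℝ] ℝ) (ν : (ℝ × E m) [⋀^Fin m]→L[ℝ] ℝ) :
    conormalWedge L ν = ∑ i : Fin (m + 1), (-1) ^ (i : ℕ) *
      (L (spacetimeFrame m i).2 * ν (i.removeNth (spacetimeFrame m))) := by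
  simp [conormalWedge, ContinuousAlternatingMap.alternatizeUncurryFin_apply]

theorem conormalWedge_smul (a : ℝ) (L : E m →L[ℝ] ℝ) (ν : (ℝ × E m) [⋀^Fin m]→L[ℝ] ℝ) :
    conormalWedge (a • L) ν = a * conormalWedge L ν := by
  simp only [conormalWedge_eq_sum, smul_apply, smul_eq_mul, Finset.mul_sum]
  exact Finset.sum_congr rfl fun i _ => by ring

theorem conormalWedge_sum {ι : Type*} (s : Finset ι) (L : ι → E m →L[ℝ] ℝ)
    (ν : (ℝ × E m) [⋀^Fin m]→L[ℝ] ℝ) :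
    conormalWedge (∑ a ∈ s, L a) ν = ∑ a ∈ s, conormalWedge (L a) ν := by
  simp only [conormalWedge_eq_sum, sum_apply, Finset.sum_mul, Finset.mul_sum]
  exact Finset.sum_comm

theorem conormalWedge_zero (ν : (ℝ × E m) [⋀^Fin m]→L[ℝ] ℝ) :
    conormalWedge (0 : E m →L[ℝ] ℝ) ν = 0 := by
  simp [conormalWedge_eq_sum]

theorem continuousAt_conormalWedge {X : Type*} [TopologicalSpace X] {L : X → E m →L[ℝ] ℝ}
    {ν : X → (ℝ × E m) [⋀^Fin m]→L[ℝ] ℝ} {x : X} (hL : ContinuousAt L x) (hν : ContinuousAt ν x) :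
    ContinuousAt (fun y => conormalWedge (L y) (ν y)) x := by
  simp only [conormalWedge_eq_sum]
  refine tendsto_finsetSum _ fun i _ => ContinuousAt.mul continuousAt_const (.mul ?_ ?_)
  · exact hL.clm_apply continuousAt_const
  · exact ((ContinuousAlternatingMap.apply ℝ (ℝ × E m) ℝ
      (i.removeNth (spacetimeFrame m))).continuous.continuousAt).comp hν

/-- Under a linear substitution in the second variable, `ι_{∂ₜ} (L ∧ ν)` transforms as a top degree
form on `ℝᵐ`. -/
theorem conormalWedge_comp (L : E m →L[ℝ] ℝ) (ν : (ℝ × E m) [⋀^Fin m]→L[ℝ] ℝ) (B : E m →L[ℝ] E m) :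
    conormalWedge (L ∘L B)
      (ν.compContinuousLinearMap ((ContinuousLinearMap.id ℝ ℝ).prodMap B)) =
        B.det * conormalWedge L ν := by
  set A := ContinuousAlternatingMap.alternatizeUncurryFin
    ((L ∘L ContinuousLinearMap.snd ℝ ℝ (E m)).smulRight ν) with hA
  let f : E m [⋀^Fin m]→L[ℝ] ℝ :=
    (A.curryLeft (1, 0)).compContinuousLinearMap (ContinuousLinearMap.inr ℝ ℝ (E m))
  have h1 := map_stdFrame_eq_det_mul B f
  have h2 : ∀ v : Fin m → E m, f v = A (Fin.cons (1, 0) fun i => ((0 : ℝ), v i)) := fun v => rfl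
  rw [h2, h2] at h1
  refine Eq.trans ?_ h1
  have h3 : (Fin.cons (1, 0) fun i => ((0 : ℝ), B (stdFrame m i)) : Fin (m + 1) → ℝ × E m) =
      fun i => (ContinuousLinearMap.id ℝ ℝ).prodMap B (spacetimeFrame m i) := by
    ext1 i
    refine Fin.cases ?_ (fun j => ?_) i <;> simp [spacetimeFrame, sliceFrame]
  rw [h3, hA, conormalWedge_eq_sum, ContinuousAlternatingMap.alternatizeUncurryFin_apply]
  refine Finset.sum_congr rfl fun i _ => ?_
  have h4 : (i.removeNth fun j => (ContinuousLinearMap.id ℝ ℝ).prodMap B (spacetimeFrame m j)) =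
    (ContinuousLinearMap.id ℝ ℝ).prodMap B ∘ i.removeNth (spacetimeFrame m) := rfl
  rw [h4]
  simp

/-- The derivative of the product of a closed form and a function of the second variable. -/
theorem extDeriv_smul_spacetimeFrame {ψ : E m → ℝ} {ν : ℝ × E m → (ℝ × E m) [⋀^Fin m]→L[ℝ] ℝ}
    {t : ℝ} {y : E m} (hψ : DifferentiableAt ℝ ψ y) (hν : DifferentiableAt ℝ ν (t, y))
    (hν' : extDeriv ν (t, y) = 0) :
    extDeriv (fun p => ψ p.2 • ν p) (t, y) (spacetimeFrame m) =
      conormalWedge (fderiv ℝ ψ y) (ν (t, y)) := by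
  have h1 : HasFDerivAt (fun p : ℝ × E m => ψ p.2)
      (fderiv ℝ ψ y ∘L ContinuousLinearMap.snd ℝ ℝ (E m)) (t, y) :=
    hψ.hasFDerivAt.comp (t, y) hasFDerivAt_snd
  have h2 := (h1.smul hν.hasFDerivAt).fderiv
  -- the `extDeriv ν` term comes with the factor `ψ y` and vanishes
  rw [extDeriv, show (fun p : ℝ × E m => ψ p.2 • ν p) = (fun p : ℝ × E m => ψ p.2) • ν from rfl, h2,
    ContinuousAlternatingMap.alternatizeUncurryFin_add,
    ContinuousAlternatingMap.alternatizeUncurryFin_smul]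
  change (ψ y • extDeriv ν (t, y) + _) _ = _
  rw [hν', smul_zero, zero_add]
  rfl

end ConormalWedge

section Orientation

variable {m : ℕ} {M : Type*} [TopologicalSpace M] [ChartedSpace (E m) M] [IsManifold (𝓡 m) ∞ M]

/-- The sign `± 1` of the chart around `c` at a point of its target: `1` where the chart preserves
the orientation. -/
def chartSign (o : OrientationForm m M) (c : M) (y : E m) : ℝ :=
  Real.sign (inChart o.form c y (stdFrame m))

theorem eq_zero_of_map_stdFrame_eq_zero {f : E m [⋀^Fin m]→L[ℝ] ℝ} (hf : f (stdFrame m) = 0) :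
    f = 0 := by
  let b := (EuclideanSpace.basisFun (Fin m) ℝ).toBasis
  have hb : (⇑b : Fin m → E m) = stdFrame m := funext fun i => by
    simp [b, stdFrame, EuclideanSpace.basisFun_apply]
  apply ContinuousAlternatingMap.toAlternatingMap_injective
  rw [f.toAlternatingMap.eq_smul_basis_det b, hb]
  have : f.toAlternatingMap (stdFrame m) = 0 := hf
  rw [this, zero_smul]
  rfl

theorem inChart_orientation_ne_zero (o : OrientationForm m M) {c : M} {y : E m}
    (hy : y ∈ (chartAt (E m) c).target) : inChart o.form c y (stdFrame m) ≠ 0 := by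
  intro h
  refine o.ne_zero ((chartAt (E m) c).symm y) ?_
  rw [eq_inChart_compContinuousLinearMap o.form ((chartAt (E m) c).map_target hy),
    (chartAt (E m) c).right_inv hy, eq_zero_of_map_stdFrame_eq_zero h]
  rfl

theorem chartSign_eventually_eq (o : OrientationForm m M) {c : M} {y : E m}
    (hy : y ∈ (chartAt (E m) c).target) : ∀ᶠ z in 𝓝 y, chartSign o c z = chartSign o c y := by
  have hc : ContinuousAt (fun z => inChart o.form c z (stdFrame m)) y :=
    (ContinuousAlternatingMap.apply ℝ (E m) ℝ (stdFrame m)).continuous.continuousAt.comp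
      ((o.smooth c).contDiffAt ((chartAt (E m) c).open_target.mem_nhds hy)).continuousAt
  rcases (inChart_orientation_ne_zero o hy).lt_or_gt with h | h
  · filter_upwards [hc.eventually (gt_mem_nhds h)] with z hz
    rw [chartSign, chartSign, Real.sign_of_neg h, Real.sign_of_neg hz]
  · filter_upwards [hc.eventually (lt_mem_nhds h)] with z hz
    rw [chartSign, chartSign, Real.sign_of_pos h, Real.sign_of_pos hz]

/-- With the orientation sign, top degree forms transform as densities: by the absolute value of the
Jacobian determinant. -/
theorem chartSign_mul_det (o : OrientationForm m M) {c c' : M} {y : E m} (hy : y ∈ overlap c c') :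
    chartSign o c y * (fderiv ℝ (transition c c') y).det =
      |(fderiv ℝ (transition c c') y).det| * chartSign o c' (transition c c' y) := by
  rw [chartSign, chartSign, inChart_transition_stdFrame o.form hy]
  set d := (fderiv ℝ (transition c c') y).det
  set a := inChart o.form c' (transition c c' y) (stdFrame m)
  rcases lt_trichotomy d 0 with hd | hd | hd
  · rcases lt_trichotomy a 0 with ha | ha | ha
    · rw [Real.sign_of_pos (mul_pos_of_neg_of_neg hd ha), Real.sign_of_neg ha, abs_of_neg hd]; ring
    · simp [ha]
    · rw [Real.sign_of_neg (mul_neg_of_neg_of_pos hd ha), Real.sign_of_pos ha, abs_of_neg hd]; ring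
  · simp [hd]
  · rcases lt_trichotomy a 0 with ha | ha | ha
    · rw [Real.sign_of_neg (mul_neg_of_pos_of_neg hd ha), Real.sign_of_neg ha, abs_of_pos hd]; ring
    · simp [ha]
    · rw [Real.sign_of_pos (mul_pos hd ha), Real.sign_of_pos ha, abs_of_pos hd]; ring

end Orientation

section Homotopy

variable {m k l : ℕ} {M : Type*} [TopologicalSpace M] [ChartedSpace (E m) M]
  {θ : E 3 → E 3 [⋀^Fin l]→L[ℝ] ℝ} {α : Form m M k}
  {F : Icc (0 : ℝ) 1 × M → QuotientTorus}

/-- A smooth map `ℝ → [0,1]` with value `0` for `t ≤ 0` and `1` for `t ≥ 1`. -/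
def smoothStep (t : ℝ) : Icc (0 : ℝ) 1 :=
  ⟨Real.smoothTransition t, Real.smoothTransition.nonneg t, Real.smoothTransition.le_one t⟩

theorem contMDiff_smoothStep : ContMDiff 𝓘(ℝ, ℝ) (𝓡∂ 1) ∞ smoothStep :=
  contMDiff_iff_comp_subtypeVal_Icc.mpr
    ⟨Real.smoothTransition.continuous.subtype_mk _, Real.smoothTransition.contDiff.contMDiff⟩

/-- The homotopy `F` in the chart around `c`, with the time reparametrized by `smoothStep` so that
it is defined for all real times. -/
def homotopyInChart (F : Icc (0 : ℝ) 1 × M → QuotientTorus) (c : M) : ℝ × E m → QuotientTorus :=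
  fun p => F (smoothStep p.1, (chartAt (E m) c).symm p.2)

theorem contDiffAt_inChart_snd (hα : IsSmoothForm α) {c : M} {t : ℝ} {y : E m}
    (hy : y ∈ (chartAt (E m) c).target) :
    ContDiffAt ℝ ∞ (fun p : ℝ × E m =>
      (inChart α c p.2).compContinuousLinearMap (ContinuousLinearMap.snd ℝ ℝ (E m))) (t, y) :=
  contDiffAt_compContinuousLinearMap
    (((hα c).contDiffAt ((chartAt (E m) c).open_target.mem_nhds hy)).comp (t, y) contDiffAt_snd)
    contDiffAt_const

variable [IsManifold (𝓡 m) ∞ M]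

theorem exists_euclideanLift_homotopyInChart
    (hF : IsSmoothOrbifoldMap ((𝓡∂ 1).prod (𝓡 m)) F) {c : M} (t : ℝ) {y : E m}
    (hy : y ∈ (chartAt (E m) c).target) :
    ∃ U u, (t, y) ∈ U ∧ IsEuclideanLift (homotopyInChart (m := m) F c) U u := by
  obtain ⟨U, g, hmem, h⟩ := hF.exists_lift (smoothStep t, (chartAt (E m) c).symm y)
  let φ : ℝ × E m → Icc (0 : ℝ) 1 × M := fun p => (smoothStep p.1, (chartAt (E m) c).symm p.2)
  let S : Set (ℝ × E m) := univ ×ˢ (chartAt (E m) c).target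
  have hS : IsOpen S := isOpen_univ.prod (chartAt (E m) c).open_target
  have hφ : ContMDiffOn 𝓘(ℝ, ℝ × E m) ((𝓡∂ 1).prod (𝓡 m)) ∞ φ S := by
    refine ContMDiffOn.prodMk ?_ ?_
    · exact (contMDiff_smoothStep.comp (contDiff_fst (𝕜 := ℝ)).contMDiff).contMDiffOn
    · exact (contMDiffOn_chart_symm (I := 𝓡 m) (n := ∞) (x := c)).comp
        (contDiff_snd (𝕜 := ℝ)).contMDiff.contMDiffOn fun p hp => hp.2
  obtain ⟨U', u, h1, h2, h3, h4, h5⟩ := exists_euclidean_lift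
    (hφ.continuousOn.isOpen_inter_preimage hS h.isOpen)
    (h.contMDiffOn.comp (hφ.mono inter_subset_left) fun p hp => hp.2) (w := (t, y))
    ⟨⟨mem_univ _, hy⟩, hmem⟩
  exact ⟨U', u, h1, h3, h4, fun p hp => by rw [h5 p hp]; exact h.proj_eq _ (h2 hp).2⟩

/-- The form `α ∧ F^*θ` on `ℝ × M`, in the chart around `c`. -/
def spacetimeForm {k l m : ℕ} {M : Type*} [TopologicalSpace M] [ChartedSpace (E m) M]
    (h : k + l = m) (α : Form m M k) (θ : E 3 → E 3 [⋀^Fin l]→L[ℝ] ℝ)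
    (F : Icc (0 : ℝ) 1 × M → QuotientTorus) (c : M) (p : ℝ × E m) :
    (ℝ × E m) [⋀^Fin m]→L[ℝ] ℝ :=
  wedge h ((inChart α c p.2).compContinuousLinearMap (ContinuousLinearMap.snd ℝ ℝ (E m)))
    (orbPull θ (homotopyInChart F c) p)

variable (h : k + l = m)

theorem contDiffAt_spacetimeForm (hα : IsSmoothForm α) (hθ : IsCrystalForm θ)
    (hF : IsSmoothOrbifoldMap ((𝓡∂ 1).prod (𝓡 m)) F) {c : M} {t : ℝ} {y : E m}
    (hy : y ∈ (chartAt (E m) c).target) :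
    ContDiffAt ℝ ∞ (spacetimeForm h α θ F c) (t, y) := by
  obtain ⟨U, u, hmem, hu⟩ := exists_euclideanLift_homotopyInChart hF t hy
  exact contDiffAt_wedge h (contDiffAt_inChart_snd hα hy) (hu.contDiffAt_orbPull hθ hmem)

theorem extDeriv_spacetimeForm (hα : IsSmoothForm α) (hα' : IsClosedForm α)
    (hθ : IsCrystalForm θ) (hF : IsSmoothOrbifoldMap ((𝓡∂ 1).prod (𝓡 m)) F) {c : M} {t : ℝ}
    {y : E m} (hy : y ∈ (chartAt (E m) c).target) :
    extDeriv (spacetimeForm h α θ F c) (t, y) = 0 := by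
  obtain ⟨U, u, hmem, hu⟩ := exists_euclideanLift_homotopyInChart hF t hy
  refine extDeriv_wedge_eq_zero h ((contDiffAt_inChart_snd hα hy).differentiableAt (by simp))
    ((hu.contDiffAt_orbPull hθ hmem).differentiableAt (by simp))
    ((contDiffAt_spacetimeForm h hα hθ hF hy).differentiableAt (by simp)) ?_
    (hu.extDeriv_orbPull hθ hmem)
  have h1 := extDeriv_pullback (x := (t, y)) (f := Prod.snd) (r := ∞)
    (((hα c).contDiffAt ((chartAt (E m) c).open_target.mem_nhds hy)).differentiableAt (by simp))
    contDiffAt_snd (by simpa using ENat.LEInfty.out)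
  rw [hα' c y hy] at h1
  simp only [fderiv_snd] at h1
  exact h1

theorem spacetimeForm_transition (hθ : IsCrystalForm θ)
    (hF : IsSmoothOrbifoldMap ((𝓡∂ 1).prod (𝓡 m)) F) {c c' : M} (t : ℝ) {y : E m}
    (hy : y ∈ overlap c c') :
    spacetimeForm h α θ F c (t, y) =
      (spacetimeForm h α θ F c' (t, transition c c' y)).compContinuousLinearMap
        ((ContinuousLinearMap.id ℝ ℝ).prodMap (fderiv ℝ (transition c c') y)) := by
  have hτ := contDiffOn_transition (m := m) c c'
  have hτy : HasFDerivAt (transition c c') (fderiv ℝ (transition c c') y) y :=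
    ((hτ.contDiffAt ((isOpen_overlap c c').mem_nhds hy)).differentiableAt (by simp)).hasFDerivAt
  obtain ⟨U, u, hmem, hu⟩ := exists_euclideanLift_homotopyInChart hF t (transition_mem_target hy)
  have h1 := hu.orbPull_comp hθ (τ := Prod.map id (transition c c')) (S := univ ×ˢ overlap c c')
    (f' := homotopyInChart F c) (y := (t, y)) (isOpen_univ.prod (isOpen_overlap c c'))
    (contDiff_id.contDiffOn.prodMap hτ)
    (fun p hp => by simp [homotopyInChart, chartAt_symm_transition hp.2]) ⟨mem_univ _, hy⟩ hmem
  have h2 : fderiv ℝ (Prod.map id (transition c c')) (t, y) =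
      (ContinuousLinearMap.id ℝ ℝ).prodMap (fderiv ℝ (transition c c') y) :=
    (HasFDerivAt.prodMap (t, y) (hasFDerivAt_id t) hτy).fderiv
  rw [spacetimeForm, spacetimeForm, wedge_compContinuousLinearMap, h1, h2, inChart_transition α hy]
  rfl

/-- On the slice `{t} × M` the form `α ∧ F^*θ` restricts to `α ∧ f^*θ`, where `f` is the value of
the homotopy at the time `t`. -/
theorem spacetimeForm_sliceFrame {Θ : Form 3 Torus l} (hθ : IsCrystalForm (liftForm Θ))
    (hF : IsSmoothOrbifoldMap ((𝓡∂ 1).prod (𝓡 m)) F) {f : M → QuotientTorus}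
    (hf : IsSmoothOrbifoldMap (𝓡 m) f) {t : ℝ} (hft : ∀ x, F (smoothStep t, x) = f x) {c : M}
    {y : E m} (hy : y ∈ (chartAt (E m) c).target) :
    spacetimeForm h α (liftForm Θ) F c (t, y) (sliceFrame m) =
      inChart (wedgeForm h α (orbifoldPullback hf Θ)) c y (stdFrame m) := by
  obtain ⟨U, u, hmem, hu⟩ := exists_euclideanLift_homotopyInChart hF t hy
  have h1 := hu.orbPull_comp hθ (τ := fun z => (t, z)) (S := univ)
    (f' := f ∘ (chartAt (E m) c).symm) (y := y) isOpen_univ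
    (contDiff_prodMk_right t).contDiffOn
    (fun z _ => by simp [homotopyInChart, hft]) (mem_univ _) hmem
  have h2 : fderiv ℝ (fun z : E m => (t, z)) y = ContinuousLinearMap.inr ℝ ℝ (E m) :=
    (hasFDerivAt_prodMk_right t y).fderiv
  have h3 : inChart (wedgeForm h α (orbifoldPullback hf Θ)) c y =
      wedge h (inChart α c y) (inChart (orbifoldPullback hf Θ) c y) :=
    wedge_compContinuousLinearMap (V := E m) (V' := E m) h _ _ _
  rw [h3, inChart_orbifoldPullback hθ hf hy, h1, h2]
  have h4 : inChart α c y = ((inChart α c y).compContinuousLinearMap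
      (ContinuousLinearMap.snd ℝ ℝ (E m))).compContinuousLinearMap
        (ContinuousLinearMap.inr ℝ ℝ (E m)) := rfl
  rw [h4, ← wedge_compContinuousLinearMap]
  rfl

end Homotopy

/-! ### Invariance of the integral -/

section Partition

variable {m : ℕ} {M : Type*} [TopologicalSpace M] [T2Space M] [CompactSpace M]
  [ChartedSpace (E m) M] [IsManifold (𝓡 m) ∞ M]

theorem tsupport_chartPartition_subset (c : M) :
    tsupport (chartPartition m M c) ⊆ (chartAt (E m) c).source :=
  (SmoothPartitionOfUnity.exists_isSubordinate_chartAt_source (𝓡 m) M).choose_spec c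

variable (m M) in
/-- The finitely many indices of the nonzero functions in the partition of unity. -/
def partitionIndices : Finset M :=
  ((chartPartition m M).locallyFinite.finite_nonempty_of_compact).toFinset

theorem chartPartition_eq_zero_of_notMem {c : M} (hc : c ∉ partitionIndices m M) (x : M) :
    chartPartition m M c x = 0 := by
  by_contra h
  exact hc ((Set.Finite.mem_toFinset _).mpr ⟨x, h⟩)

theorem sum_chartPartition (x : M) : ∑ c ∈ partitionIndices m M, chartPartition m M c x = 1 := by
  rw [← (chartPartition m M).sum_eq_one (mem_univ x)]
  refine (finsum_eq_sum_of_support_subset _ fun c hc => ?_).symm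
  by_contra h
  exact hc (chartPartition_eq_zero_of_notMem h x)

/-- The function with index `a` of the partition of unity, in the chart around `c`. -/
def partitionInChart (a c : M) : E m → ℝ := fun y =>
  chartPartition m M a ((chartAt (E m) c).symm y)

theorem contDiffAt_partitionInChart (a : M) {c : M} {y : E m}
    (hy : y ∈ (chartAt (E m) c).target) : ContDiffAt ℝ ∞ (partitionInChart a c) y :=
  (((chartPartition m M a).contMDiff _).comp y (contMDiffAt_chart_symm hy)).contDiffAt

theorem partitionInChart_eventuallyEq_zero {a c : M} {y : E m}
    (hy : y ∈ (chartAt (E m) c).target)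
    (ha : (chartAt (E m) c).symm y ∉ (chartAt (E m) a).source) :
    partitionInChart a c =ᶠ[𝓝 y] fun _ => 0 := by
  have h1 := notMem_tsupport_iff_eventuallyEq.mp
    (fun hmem => ha (tsupport_chartPartition_subset a hmem))
  exact ((chartAt (E m) c).symm.continuousAt hy).eventually h1

/-- The compact subset of the target of the chart around `c` outside which the function with index
`c` of the partition of unity vanishes. -/
def partitionSupport (c : M) : Set (E m) := chartAt (E m) c '' tsupport (chartPartition m M c)

theorem isCompact_partitionSupport (c : M) : IsCompact (partitionSupport (m := m) c) :=
  (isClosed_tsupport _).isCompact.image_of_continuousOn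
    ((chartAt (E m) c).continuousOn.mono (tsupport_chartPartition_subset c))

theorem partitionSupport_subset (c : M) :
    partitionSupport (m := m) c ⊆ (chartAt (E m) c).target := by
  rintro _ ⟨x, hx, rfl⟩
  exact (chartAt (E m) c).map_source (tsupport_chartPartition_subset c hx)

theorem partitionInChart_self_eventuallyEq_zero {c : M} {y : E m}
    (hy : y ∈ (chartAt (E m) c).target) (hyK : y ∉ partitionSupport c) :
    partitionInChart c c =ᶠ[𝓝 y] fun _ => 0 := by
  have h1 := (notMem_tsupport_iff_eventuallyEq (f := chartPartition m M c)
    (x := (chartAt (E m) c).symm y)).mp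
    (fun hmem => hyK ⟨_, hmem, (chartAt (E m) c).right_inv hy⟩)
  exact ((chartAt (E m) c).symm.continuousAt hy).eventually h1

/-- A function that is continuous on an open set and vanishes outside a compact subset is integrable
on that set. -/
theorem integrableOn_of_continuousOn {V K : Set (E m)} (hV : IsOpen V) (hK : IsCompact K)
    (hKV : K ⊆ V) {f : E m → ℝ} (hf : ContinuousOn f V) (h0 : ∀ y ∈ V, y ∉ K → f y = 0) :
    IntegrableOn f V :=
  ((hf.mono hKV).integrableOn_compact hK).of_forall_sdiff_eq_zero hV.measurableSet
    fun y hy => h0 y hy.1 hy.2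

variable (o : OrientationForm m M)

/-- The function with index `c` of the partition of unity times the orientation sign, in the chart
around `c`, extended by zero. -/
def signedWeight (c : M) : E m → ℝ :=
  (chartAt (E m) c).target.indicator fun y => chartSign o c y * partitionInChart c c y

theorem signedWeight_eventuallyEq {c : M} {y : E m} (hy : y ∈ (chartAt (E m) c).target) :
    signedWeight o c =ᶠ[𝓝 y] fun z => chartSign o c y * partitionInChart c c z := by
  filter_upwards [(chartAt (E m) c).open_target.mem_nhds hy, chartSign_eventually_eq o hy]
    with z hz hz'
  rw [signedWeight, indicator_of_mem hz, hz']

theorem signedWeight_eq_zero {c : M} {y : E m} (hy : y ∉ partitionSupport c) :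
    signedWeight o c y = 0 := by
  by_cases hyV : y ∈ (chartAt (E m) c).target
  · rw [(signedWeight_eventuallyEq o hyV).eq_of_nhds,
      (partitionInChart_self_eventuallyEq_zero hyV hy).eq_of_nhds, mul_zero]
  · exact indicator_of_notMem hyV _

theorem signedWeight_eventuallyEq_zero {c : M} {y : E m} (hy : y ∉ partitionSupport c) :
    ∀ᶠ z in 𝓝 y, signedWeight o c z = 0 := by
  filter_upwards [(isCompact_partitionSupport c).isClosed.isOpen_compl.mem_nhds hy] with z hz
  exact signedWeight_eq_zero o hz

end Partition

section Invariance

variable {m k l : ℕ} {M : Type*} [TopologicalSpace M] [T2Space M] [CompactSpace M]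
  [ChartedSpace (E m) M] [IsManifold (𝓡 m) ∞ M] {θ : E 3 → E 3 [⋀^Fin l]→L[ℝ] ℝ} {α : Form m M k}
  {F : Icc (0 : ℝ) 1 × M → QuotientTorus} (h : k + l = m) (o : OrientationForm m M)

/-- The density on `M` of the top degree form `ι_{∂ₜ} (dρ_a ∧ α ∧ F^*θ)` at the time `t`, in the
chart around `c`. -/
def boundaryDensity {k l m : ℕ} {M : Type*} [TopologicalSpace M] [T2Space M] [CompactSpace M]
    [ChartedSpace (E m) M] [IsManifold (𝓡 m) ∞ M] (h : k + l = m) (o : OrientationForm m M)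
    (α : Form m M k) (θ : E 3 → E 3 [⋀^Fin l]→L[ℝ] ℝ) (F : Icc (0 : ℝ) 1 × M → QuotientTorus)
    (t : ℝ) (a c : M) (y : E m) : ℝ :=
  chartSign o c y *
    conormalWedge (fderiv ℝ (partitionInChart a c) y) (spacetimeForm h α θ F c (t, y))

theorem continuousOn_boundaryDensity (hα : IsSmoothForm α) (hθ : IsCrystalForm θ)
    (hF : IsSmoothOrbifoldMap ((𝓡∂ 1).prod (𝓡 m)) F) (t : ℝ) (a c : M) :
    ContinuousOn (boundaryDensity h o α θ F t a c) (chartAt (E m) c).target := by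
  intro y hy
  have h1 : ContinuousAt (chartSign o c) y :=
    (continuousAt_const (y := chartSign o c y)).congr
      (.mono (chartSign_eventually_eq o hy) fun z hz => hz.symm)
  have h2 : ContinuousAt (fderiv ℝ (partitionInChart a c)) y :=
    ((contDiffAt_partitionInChart a hy).fderiv_right (m := 0) (by simp)).continuousAt
  have h3 : ContinuousAt (fun z => spacetimeForm h α θ F c (t, z)) y :=
    (contDiffAt_spacetimeForm h hα hθ hF hy).continuousAt.comp
      (f := fun z => (t, z)) (Continuous.prodMk_right t).continuousAt
  exact (h1.mul (continuousAt_conormalWedge h2 h3)).continuousWithinAt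

theorem boundaryDensity_eq_zero {t : ℝ} {a c : M} {y : E m}
    (hy : partitionInChart a c =ᶠ[𝓝 y] fun _ => 0) : boundaryDensity h o α θ F t a c y = 0 := by
  rw [boundaryDensity, hy.fderiv_eq, fderiv_fun_const, Pi.zero_apply, conormalWedge_zero, mul_zero]

theorem boundaryDensity_transition (hθ : IsCrystalForm θ)
    (hF : IsSmoothOrbifoldMap ((𝓡∂ 1).prod (𝓡 m)) F) (t : ℝ) (a : M) {c c' : M} {y : E m}
    (hy : y ∈ overlap c c') :
    boundaryDensity h o α θ F t a c y = |(fderiv ℝ (transition c c') y).det| *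
      boundaryDensity h o α θ F t a c' (transition c c' y) := by
  have hτ : DifferentiableAt ℝ (transition c c') y :=
    ((contDiffOn_transition c c').contDiffAt ((isOpen_overlap c c').mem_nhds hy)).differentiableAt
      (by simp)
  have h1 : partitionInChart a c =ᶠ[𝓝 y] partitionInChart a c' ∘ transition c c' := by
    filter_upwards [(isOpen_overlap c c').mem_nhds hy] with z hz
    rw [Function.comp_apply, partitionInChart, partitionInChart, chartAt_symm_transition hz]
  rw [boundaryDensity, boundaryDensity, h1.fderiv_eq,
    fderiv_comp y ((contDiffAt_partitionInChart a (transition_mem_target hy)).differentiableAt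
      (by simp)) hτ, spacetimeForm_transition h hθ hF t hy, conormalWedge_comp, ← mul_assoc,
    chartSign_mul_det o hy, mul_assoc]

/-- The differentials of the functions of the partition of unity add up to zero. -/
theorem sum_boundaryDensity (t : ℝ) {c : M} {y : E m} (hy : y ∈ (chartAt (E m) c).target) :
    ∑ a ∈ partitionIndices m M, boundaryDensity h o α θ F t a c y = 0 := by
  have h1 : ∑ a ∈ partitionIndices m M, fderiv ℝ (partitionInChart a c) y = 0 := by
    rw [← fderiv_fun_sum fun a _ =>
      (contDiffAt_partitionInChart a hy).differentiableAt (by simp)]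
    have h2 : (fun z => ∑ a ∈ partitionIndices m M, partitionInChart a c z) = fun _ => (1 : ℝ) :=
      funext fun z => sum_chartPartition _
    rw [h2, fderiv_fun_const, Pi.zero_apply]
  simp only [boundaryDensity]
  rw [← Finset.mul_sum, ← conormalWedge_sum, h1, conormalWedge_zero, mul_zero]

/-- The boundary densities, each integrated in its own chart, add up to zero. Each of them is cut
into pieces by the partition of unity, and the pieces with the same support are collected in a
common chart. -/
theorem sum_integral_boundaryDensity (hα : IsSmoothForm α) (hθ : IsCrystalForm θ)
    (hF : IsSmoothOrbifoldMap ((𝓡∂ 1).prod (𝓡 m)) F) (t : ℝ) :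
    ∑ c ∈ partitionIndices m M,
      ∫ y in (chartAt (E m) c).target, boundaryDensity h o α θ F t c c y = 0 := by
  have hcont : ∀ a b c : M, ContinuousOn
      (fun y => partitionInChart b c y * boundaryDensity h o α θ F t a c y)
      (chartAt (E m) c).target := fun a b c =>
    ContinuousOn.mul
      (fun y hy => (contDiffAt_partitionInChart b hy).continuousAt.continuousWithinAt)
      (continuousOn_boundaryDensity h o hα hθ hF t a c)
  have hint1 : ∀ b c : M, IntegrableOn
      (fun y => partitionInChart b c y * boundaryDensity h o α θ F t c c y)
      (chartAt (E m) c).target := fun b c =>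
    integrableOn_of_continuousOn (chartAt (E m) c).open_target (isCompact_partitionSupport c)
      (partitionSupport_subset c) (hcont c b c) fun y hy hyK => by
        rw [boundaryDensity_eq_zero h o (partitionInChart_self_eventuallyEq_zero hy hyK), mul_zero]
  have hint2 : ∀ a c : M, IntegrableOn
      (fun y => partitionInChart c c y * boundaryDensity h o α θ F t a c y)
      (chartAt (E m) c).target := fun a c =>
    integrableOn_of_continuousOn (chartAt (E m) c).open_target (isCompact_partitionSupport c)
      (partitionSupport_subset c) (hcont a c c) fun y hy hyK => by
        rw [(partitionInChart_self_eventuallyEq_zero hy hyK).eq_of_nhds, zero_mul]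
  calc ∑ c ∈ partitionIndices m M,
        ∫ y in (chartAt (E m) c).target, boundaryDensity h o α θ F t c c y
      = ∑ c ∈ partitionIndices m M, ∑ c' ∈ partitionIndices m M,
          ∫ y in (chartAt (E m) c).target,
            partitionInChart c' c y * boundaryDensity h o α θ F t c c y := by
        refine Finset.sum_congr rfl fun c _ => ?_
        rw [← integral_finsetSum _ fun c' _ => hint1 c' c]
        refine integral_congr_ae (.of_forall fun y => ?_)
        have h1 : ∑ c' ∈ partitionIndices m M, partitionInChart c' c y = 1 := sum_chartPartition _
        simp only [← Finset.sum_mul, h1, one_mul]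
    _ = ∑ c ∈ partitionIndices m M, ∑ c' ∈ partitionIndices m M,
          ∫ y in (chartAt (E m) c').target,
            partitionInChart c' c' y * boundaryDensity h o α θ F t c c' y := by
        refine Finset.sum_congr rfl fun c _ => Finset.sum_congr rfl fun c' _ => ?_
        refine setIntegral_eq_of_transition (fun y hy hy' => ?_) (fun y hy hy' => ?_)
          fun y hy => ?_
        · rw [(partitionInChart_eventuallyEq_zero hy hy').eq_of_nhds, zero_mul]
        · rw [boundaryDensity_eq_zero h o (partitionInChart_eventuallyEq_zero hy hy'), mul_zero]
        · rw [boundaryDensity_transition h o hθ hF t c hy, partitionInChart, partitionInChart,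
            chartAt_symm_transition hy, mul_left_comm]
    _ = ∑ c' ∈ partitionIndices m M, ∫ y in (chartAt (E m) c').target, (0 : ℝ) := by
        rw [Finset.sum_comm]
        refine Finset.sum_congr rfl fun c' _ => ?_
        rw [← integral_finsetSum _ fun c _ => hint2 c c']
        refine setIntegral_congr_fun (chartAt (E m) c').open_target.measurableSet fun y hy => ?_
        simp only [← Finset.mul_sum, sum_boundaryDensity h o t hy, mul_zero]
    _ = 0 := by simp

/-- The integral of `α ∧ f_t^*θ` over `M`, where `f_t` is the value of the (reparametrized) homotopy
at the time `t`. -/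
def slicedIntegral {k l m : ℕ} {M : Type*} [TopologicalSpace M] [T2Space M] [CompactSpace M]
    [ChartedSpace (E m) M] [IsManifold (𝓡 m) ∞ M] (h : k + l = m) (o : OrientationForm m M)
    (α : Form m M k) (θ : E 3 → E 3 [⋀^Fin l]→L[ℝ] ℝ) (F : Icc (0 : ℝ) 1 × M → QuotientTorus)
    (t : ℝ) : ℝ :=
  ∑ c ∈ partitionIndices m M,
    ∫ y, (signedWeight o c y • spacetimeForm h α θ F c (t, y)) (sliceFrame m)

theorem contDiff_signedWeight_smul (hα : IsSmoothForm α) (hθ : IsCrystalForm θ)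
    (hF : IsSmoothOrbifoldMap ((𝓡∂ 1).prod (𝓡 m)) F) (c : M) :
    ContDiff ℝ ∞ fun p : ℝ × E m => signedWeight o c p.2 • spacetimeForm h α θ F c p := by
  refine contDiff_iff_contDiffAt.mpr fun ⟨t, y⟩ => ?_
  by_cases hy : y ∈ partitionSupport c
  · have hyV := partitionSupport_subset c hy
    have h1 : ContDiffAt ℝ ∞ (signedWeight o c) y :=
      (contDiffAt_const.mul (contDiffAt_partitionInChart c hyV)).congr_of_eventuallyEq
        (signedWeight_eventuallyEq o hyV)
    exact (h1.comp (t, y) contDiffAt_snd).smul (contDiffAt_spacetimeForm h hα hθ hF hyV)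
  · refine (contDiffAt_const (c := 0)).congr_of_eventuallyEq ?_
    filter_upwards [(continuous_snd.tendsto (t, y)).eventually
      (signedWeight_eventuallyEq_zero o hy)] with p hp
    rw [hp, zero_smul]

theorem extDeriv_signedWeight_smul (hα : IsSmoothForm α) (hα' : IsClosedForm α)
    (hθ : IsCrystalForm θ) (hF : IsSmoothOrbifoldMap ((𝓡∂ 1).prod (𝓡 m)) F) (c : M) (t : ℝ)
    (y : E m) :
    extDeriv (fun p : ℝ × E m => signedWeight o c p.2 • spacetimeForm h α θ F c p) (t, y)
        (spacetimeFrame m) =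
      (chartAt (E m) c).target.indicator (boundaryDensity h o α θ F t c c) y := by
  by_cases hy : y ∈ (chartAt (E m) c).target
  · have hd := (contDiffAt_partitionInChart c hy).differentiableAt (by simp)
    have h1 := signedWeight_eventuallyEq o hy
    rw [indicator_of_mem hy, extDeriv_smul_spacetimeFrame
      ((hd.const_mul _).congr_of_eventuallyEq h1)
      ((contDiffAt_spacetimeForm h hα hθ hF hy).differentiableAt (by simp))
      (extDeriv_spacetimeForm h hα hα' hθ hF hy), h1.fderiv_eq, fderiv_const_mul hd,
      conormalWedge_smul, boundaryDensity]
  · have hyK : y ∉ partitionSupport c := fun hyK => hy (partitionSupport_subset c hyK)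
    have h1 : (fun p : ℝ × E m => signedWeight o c p.2 • spacetimeForm h α θ F c p)
        =ᶠ[𝓝 (t, y)] fun _ => 0 := by
      filter_upwards [(continuous_snd.tendsto (t, y)).eventually
        (signedWeight_eventuallyEq_zero o hyK)] with p hp
      rw [hp, zero_smul]
    rw [indicator_of_notMem hy, h1.extDeriv_eq, extDeriv_apply (differentiableAt_const _)]
    simp

/-- The integral of `α ∧ f_t^*θ` over `M` does not depend on the time `t`. -/
theorem slicedIntegral_eq (hα : IsSmoothForm α) (hα' : IsClosedForm α) (hθ : IsCrystalForm θ)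
    (hF : IsSmoothOrbifoldMap ((𝓡∂ 1).prod (𝓡 m)) F) (s t : ℝ) :
    slicedIntegral h o α θ F s = slicedIntegral h o α θ F t := by
  have hder : ∀ t, HasDerivAt (slicedIntegral h o α θ F) 0 t := by
    intro t
    rw [← sum_integral_boundaryDensity h o hα hθ hF t]
    refine HasDerivAt.fun_sum fun c _ => ?_
    have h1 := hasDerivAt_integral_sliceFrame (contDiff_signedWeight_smul h o hα hθ hF c)
      (isCompact_partitionSupport c)
      (fun t y hy => by rw [signedWeight_eq_zero o hy, zero_smul]) t
    simp only [extDeriv_signedWeight_smul h o hα hα' hθ hF,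
      integral_indicator (chartAt (E m) c).open_target.measurableSet] at h1
    exact h1
  exact is_const_of_deriv_eq_zero (fun t => (hder t).differentiableAt) (fun t => (hder t).deriv) s t

/-- At a time at which the homotopy is `f`, the sliced integral is the integral of `α ∧ f^*Θ`. -/
theorem slicedIntegral_eq_integralForm {Θ : Form 3 Torus l} (hθ : IsCrystalForm (liftForm Θ))
    (hF : IsSmoothOrbifoldMap ((𝓡∂ 1).prod (𝓡 m)) F) {f : M → QuotientTorus}
    (hf : IsSmoothOrbifoldMap (𝓡 m) f) {t : ℝ} (hft : ∀ x, F (smoothStep t, x) = f x) :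
    slicedIntegral h o α (liftForm Θ) F t =
      integralForm o (wedgeForm h α (orbifoldPullback hf Θ)) := by
  rw [integralForm, finsum_eq_sum_of_support_subset (s := partitionIndices m M)]
  · refine Finset.sum_congr rfl fun c _ => ?_
    rw [← integral_indicator (chartAt (E m) c).open_target.measurableSet]
    refine integral_congr_ae (.of_forall fun y => ?_)
    by_cases hy : y ∈ (chartAt (E m) c).target
    · simp only [indicator_of_mem hy, signedWeight]
      change (chartSign o c y * partitionInChart c c y) *
        spacetimeForm h α (liftForm Θ) F c (t, y) (sliceFrame m) = _
      rw [spacetimeForm_sliceFrame h hθ hF hf hft hy, mul_assoc]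
      rfl
    · simp [indicator_of_notMem hy, signedWeight]
  · intro c hc
    by_contra hmem
    exact hc (by simp [chartPartition_eq_zero_of_notMem hmem])

end Invariance

end OrbifoldHomotopy

end
open OrbifoldHomotopy in
theorem mainTheorem5 {m k l : ℕ} (hkl : k + l = m)
    {M : Type*} [TopologicalSpace M] [T2Space M] [CompactSpace M]
    [ChartedSpace (EuclideanSpace ℝ (Fin m)) M] [IsManifold (𝓡 m) ∞ M]
    (o : OrientationForm m M)
    (α : Form m M k) (hα : IsSmoothForm α) (hα' : IsClosedForm α)
    (Θ : Form 3 Torus l) (hΘ : IsSmoothForm Θ) (hΘ' : IsClosedForm Θ) (hinv : IsInvariantForm Θ) :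
    (∀ (f : M → QuotientTorus) (hf : IsSmoothOrbifoldMap (𝓡 m) f),
      IsSmoothForm (orbifoldPullback hf Θ) ∧
      ∀ (U : Set M) (g : M → Torus), IsSmoothLift (𝓡 m) f U g →
        ∀ x ∈ U, orbifoldPullback hf Θ x = pullback (n := m) g Θ x) ∧
    ∀ (f₀ f₁ : M → QuotientTorus)
      (h₀ : IsSmoothOrbifoldMap (𝓡 m) f₀) (h₁ : IsSmoothOrbifoldMap (𝓡 m) f₁),
      SmoothlyHomotopic m f₀ f₁ →
        integralForm o (wedgeForm hkl α (orbifoldPullback h₀ Θ)) =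
          integralForm o (wedgeForm hkl α (orbifoldPullback h₁ Θ)) := by
  have hθ := isCrystalForm_liftForm hΘ hΘ' hinv
  refine ⟨fun f hf => ⟨isSmoothForm_orbifoldPullback hθ hf, fun U g h x hx =>
    orbifoldPullback_eq_pullback hθ hf h hx⟩, fun f₀ f₁ h₀ h₁ ⟨F, hF, hF₀, hF₁⟩ => ?_⟩
  have hs₀ : smoothStep 0 = 0 := Subtype.ext Real.smoothTransition.zero
  have hs₁ : smoothStep 1 = 1 := Subtype.ext Real.smoothTransition.one
  rw [← slicedIntegral_eq_integralForm hkl o hθ hF h₀ (t := 0) (fun x => by rw [hs₀, hF₀]),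
    ← slicedIntegral_eq_integralForm hkl o hθ hF h₁ (t := 1) (fun x => by rw [hs₁, hF₁])]
  exact slicedIntegral_eq hkl o hα hα' hθ hF 0 1
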